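/- Let $m\in\mathbb N$, $L>0$, $\varSigma=[0,L]$, $p\in[2,\infty]$, and fix boundary points $q(0),q(L)\in\mathbb R^m$ and unit vectors $N(0),N(L)\in\mathbb S\subset\mathbb R^m$. *Smooth curves.* For a curve $\gamma\in W^{1,\infty}(\varSigma;\mathbb R^m)$ with logarithmic strain $\sigma_\gamma=\log|\gamma'|\in L^\infty$ let $\tau_\gamma=\gamma'/|\gamma'|$ be the unit tangent, $\kappa_\gamma=|\gamma'|^{-1}\tau_\gamma'$ the curvature vector (if $\tau_\gamma$ is weakly differentiable), and $\mathcal E(\gamma)=\frac12\int_0^L|\kappa_\gamma|^2|\gamma'|\,dt$. Let $\mathcal C$ be the set of such $\gamma$ that lie in $W^{2,p}(\varSigma;\mathbb R^m)$ and satisfy $\gamma(0)=q(0)$, $\gamma(L)=q(L)$, $\tau_\gamma(0)=N(0)$, $\tau_\gamma(L)=N(L)$, $\sigma_\gamma=0$. For $K_1\ge0$ let $$\mathcal A=\{\gamma\in\mathcal C : \operatorname{ess\,sup}|\gamma''|\le K_1,\ \operatorname{ess\,sup}|\gamma'''|\le K_1\}$$ (weak derivatives); for $\gamma\in\mathcal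 A$ the curvature $\kappa_\gamma$ is identified with its continuous representative. *Polygons.* For a finite partition $T$ of $\varSigma$ into nondegenerate compact intervals (edges), with vertices $0=t_0<t_1<\dots<t_{k+1}=L$, let $I_j=[t_j,t_{j+1}]$, $0\le j\le k$, be the edges, $\ell_0(I_j)=t_{j+1}-t_j$, $h(T)=\max_j\ell_0(I_j)$, and for an interior vertex $t_i$, $1\le i\le k$, let $\bar I(t_i)$ be the interval between the midpoints of $I_{i-1}$ and $I_i$. For $P\colon\{t_0,\dots,t_{k+1}\}\to\mathbb R^m$ with $P(t_j)\neq P(t_{j+1})$ for all $j$, put $\ell_P(I_j)=|P(t_{j+1})-P(t_j)|$, $\sigma_P(I_j)=\log(\ell_P(I_j)/\ell_0(I_j))$, $\tau_P(I_j)=(P(t_{j+1})-P(t_j))/\ell_P(I_j)$, and for $1\le i\le k$ $$\bar\ell_P(t_i)=\tfrac12(\ell_P(I_{i-1})+\ell_P(I_i)),\quad \kappa_P(t_i)=\frac{\tau_P(I_i)-\tau_P(I_{i-1})}{\bar\ell_P(t_i)},\quad \alpha_P(t_i)=\angle(\tau_P(I_{i-1}),\tau_P(I_i)),$$ and $\mathcal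 E_T(P)=\frac12\sum_{i=1}^k\alpha_P(t_i)^2/\bar\ell_P(t_i)$. Let $\mathcal C_T$ be the set of such $P$ with $P(0)=q(0)$, $P(L)=q(L)$, $\tau_P(I_0)=N(0)$, $\tau_P(I_k)=N(L)$ and $\sigma_P=0$ on every edge. For $K_2\ge0$ let $$\mathcal A_T=\Big\{P\in\mathcal C_T : \max_{1\le i\le k}|\kappa_P(t_i)|\le K_2,\ \sum_{i=1}^{k-1}|\kappa_P(t_{i+1})-\kappa_P(t_i)|\le K_2\Big\}.$$ Let $\mathcal I_T(P)\colon\varSigma\to\mathbb R^m$ be the continuous, piecewise affine interpolation of $P$. **Theorem (Sampling Operator).** There are constants $h_0>0$, $C\ge0$ and $K_2\ge0$ (depending only on $m$, $L$, $p$, $q$, $N$, $K_1$) such that every partition $T$ of $\varSigma$ with $h(T)\le h_0$ has at least one interior vertex and there is an operator $\mathcal S_T\colon\mathcal A\to\mathcal C_T$ with the following properties for all $\gamma\in\mathcal A$: 1. $|\mathcal E_T(\mathcal S_T(\gamma))-\mathcal E(\gamma)|\le C\,h(T)$; 2. $\|\mathcal I_T(\mathcal S_T(\gamma))-\gamma\|_{W^{1,\infty}}\le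 C\,h(T)$; 3. (a) $\sup_{r\in\bar I(t_i)}|\kappa_{\mathcal S_T(\gamma)}(t_i)-\kappa_\gamma(r)|\le C\,h(T)$ for every interior vertex $t_i$; (b) $\sup_{r\in I_0}|\kappa_{\mathcal S_T(\gamma)}(t_1)-\kappa_\gamma(r)|\le C\,h(T)$ and $\sup_{r\in I_k}|\kappa_{\mathcal S_T(\gamma)}(t_k)-\kappa_\gamma(r)|\le C\,h(T)$; 4. $\mathcal S_T(\gamma)\in\mathcal A_T$, i.e. $\mathcal S_T(\mathcal A)\subset\mathcal A_T$ with this $K_2$. -/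

import Mathlib

open MeasureTheory Set
open scoped ENNReal NNReal ContDiff

noncomputable section

namespace Elastica

/-- Euclidean space `ℝᵐ`. -/
abbrev E (m : ℕ) : Type := EuclideanSpace ℝ (Fin m)

/-! ### Sobolev spaces on the interval `(0, L)` -/

/-- Lebesgue measure on the open interval `(0, L)`. -/
def intervalMeasure (L : ℝ) : Measure ℝ := volume.restrict (Ioo 0 L)

/-- Smooth test functions with compact support in the open interval `(0, L)`. -/
def IsTestFunction (L : ℝ) (φ : ℝ → ℝ) : Prop :=
  ContDiff ℝ ∞ φ ∧ HasCompactSupport φ ∧ tsupport φ ⊆ Ioo 0 L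

section Sobolev

variable {F : Type*} [NormedAddCommGroup F] [NormedSpace ℝ F]

/-- `v` is a `k`-th weak derivative of `u` on `(0, L)`. -/
def HasWeakDeriv (L : ℝ) (k : ℕ) (u v : ℝ → F) : Prop :=
  LocallyIntegrableOn u (Ioo 0 L) ∧ LocallyIntegrableOn v (Ioo 0 L) ∧
    ∀ φ : ℝ → ℝ, IsTestFunction L φ →
      ∫ t in Ioo 0 L, iteratedDeriv k φ t • u t = (-1 : ℝ) ^ k • ∫ t in Ioo 0 L, φ t • v t

open Classical in
/-- The `k`-th weak derivative of `u` on `(0, L)`; it is unique up to null sets when it exists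
(and is set to `0` when it does not exist). -/
def weakDeriv (L : ℝ) (k : ℕ) (u : ℝ → F) : ℝ → F :=
  if h : ∃ v, HasWeakDeriv L k u v then h.choose else 0

open Classical in
/-- The Sobolev seminorm `|u|_{W^{k,p}}`, i.e. the `L^p` norm of the `k`-th weak derivative on
`(0, L)`, with value `∞` when the `k`-th weak derivative does not exist. -/
def sobolevSeminorm (L : ℝ) (k : ℕ) (p : ℝ≥0∞) (u : ℝ → F) : ℝ≥0∞ :=
  if ∃ v, HasWeakDeriv L k u v then eLpNorm (weakDeriv L k u) p (intervalMeasure L) else ⊤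

/-- The Sobolev norm `‖u‖_{W^{k,p}}`, as the sum of the seminorms of orders `0, …, k`. -/
def sobolevNorm (L : ℝ) (k : ℕ) (p : ℝ≥0∞) (u : ℝ → F) : ℝ≥0∞ :=
  ∑ j ∈ Finset.range (k + 1), sobolevSeminorm L j p u

/-- Membership in the Sobolev space `W^{k,p}` on `(0, L)`. -/
def MemSobolev (L : ℝ) (k : ℕ) (p : ℝ≥0∞) (u : ℝ → F) : Prop :=
  sobolevNorm L k p u < ⊤

open Classical in
/-- The representative of `u` (up to equality almost everywhere on `(0, L)`) that is continuous
on `[0, L]`, when there is one; for `0 < L` its values on `[0, L]` are unique. -/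
def contRep (L : ℝ) (u : ℝ → F) : ℝ → F :=
  if h : ∃ v : ℝ → F, ContinuousOn v (Icc 0 L) ∧ u =ᵐ[intervalMeasure L] v then h.choose else u

end Sobolev

/-! ### Smooth curves -/

variable {m : ℕ} {L : ℝ}

/-- A continuous parametrised curve `[0, L] → ℝᵐ`. Every element of `W^{1,p}(0, L; ℝᵐ)` has
exactly one continuous representative on `[0, L]`, so spaces of Sobolev curves are sets of such
curves. -/
abbrev Curve (m : ℕ) (L : ℝ) : Type := C(Icc (0 : ℝ) L, E m)

/-- The curve as a function on `ℝ` (constant outside of `[0, L]`); only its values on `[0, L]`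
matter below. -/
def Curve.extend (hL : 0 < L) (γ : Curve m L) : ℝ → E m := IccExtend hL.le γ

/-- The first weak derivative `γ'`. -/
def velocity (hL : 0 < L) (γ : Curve m L) : ℝ → E m := weakDeriv L 1 (γ.extend hL)

/-- The logarithmic strain `σ_γ = log |γ'|`. -/
def strain (hL : 0 < L) (γ : Curve m L) : ℝ → ℝ := fun t => Real.log ‖velocity hL γ t‖

/-- Lipschitz immersions: `γ ∈ W^{1,∞}` with essentially bounded logarithmic strain.
(As `Real.log 0 = 0`, it is required separately that `γ' ≠ 0` almost everywhere.) -/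
def IsLipschitzImmersion (hL : 0 < L) (γ : Curve m L) : Prop :=
  MemSobolev L 1 ⊤ (γ.extend hL) ∧
    (∀ᵐ t ∂intervalMeasure L, velocity hL γ t ≠ 0) ∧
    eLpNorm (strain hL γ) ⊤ (intervalMeasure L) < ⊤

/-- The configuration space `Imm^{2,p}` of Lipschitz immersions of class `W^{2,p}`. -/
def smoothConfig (hL : 0 < L) (p : ℝ≥0∞) : Set (Curve m L) :=
  {γ | IsLipschitzImmersion hL γ ∧ MemSobolev L 2 p (γ.extend hL)}

/-- The unit tangent field `τ_γ = γ' / |γ'|` (its continuous representative). -/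
def unitTangent (hL : 0 < L) (γ : Curve m L) : ℝ → E m :=
  contRep L fun t => ‖velocity hL γ t‖⁻¹ • velocity hL γ t

/-- The curvature vector `κ_γ = |γ'|⁻¹ τ_γ'` (its continuous representative, if there is one). -/
def curvature (hL : 0 < L) (γ : Curve m L) : ℝ → E m :=
  contRep L fun t => ‖velocity hL γ t‖⁻¹ • weakDeriv L 1 (unitTangent hL γ) t

/-- The Euler-Bernoulli bending energy `½ ∫ |κ_γ|² |γ'| dt`. -/
def bendingEnergy (hL : 0 < L) (γ : Curve m L) : ℝ :=
  (1 / 2) * ∫ t in Ioo 0 L, ‖curvature hL γ t‖ ^ 2 * ‖velocity hL γ t‖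

/-- Clamped boundary conditions: end points and unit tangents at both ends. -/
structure BoundaryData (m : ℕ) where
  /-- the end point at parameter `0` -/
  startPoint : E m
  /-- the end point at parameter `L` -/
  endPoint : E m
  /-- the unit tangent at parameter `0` -/
  startTangent : Metric.sphere (0 : E m) 1
  /-- the unit tangent at parameter `L` -/
  endTangent : Metric.sphere (0 : E m) 1

/-- The feasible set of curves in `Imm^{2,p}` that satisfy the boundary conditions and have
vanishing logarithmic strain. -/
def smoothFeasible (hL : 0 < L) (p : ℝ≥0∞) (B : BoundaryData m) : Set (Curve m L) :=
  {γ | γ ∈ smoothConfig hL p ∧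
    γ.extend hL 0 = B.startPoint ∧ γ.extend hL L = B.endPoint ∧
    unitTangent hL γ 0 = B.startTangent ∧ unitTangent hL γ L = B.endTangent ∧
    strain hL γ =ᵐ[intervalMeasure L] 0}

/-- The smooth a priori set: feasible curves whose `W^{2,∞}` and `W^{3,∞}` seminorms are bounded
by `K₁`. -/
def smoothPriors (hL : 0 < L) (p : ℝ≥0∞) (B : BoundaryData m) (K₁ : ℝ≥0) : Set (Curve m L) :=
  {γ | γ ∈ smoothFeasible hL p B ∧
    sobolevSeminorm L 2 ⊤ (γ.extend hL) ≤ K₁ ∧ sobolevSeminorm L 3 ⊤ (γ.extend hL) ≤ K₁}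

/-! ### IntervalPartitions and polygons -/

/-- A finite partition of `[0, L]` with `k` interior vertices. Its vertices are indexed by
`Fin (k + 2)`, its edges by `Fin (k + 1)`, its interior vertices by `Fin k`: the edge `I` has the
left vertex `I.castSucc` and the right vertex `I.succ`; the interior vertex `i` is the vertex
`i.castSucc.succ`, its preceding edge is `i.castSucc` and its following edge is `i.succ`. -/
structure IntervalPartition (L : ℝ) where
  /-- the number of interior vertices -/
  k : ℕ
  /-- the vertices, in increasing order -/
  vertex : Fin (k + 2) → ℝ
  strictMono : StrictMono vertex
  vertex_zero : vertex 0 = 0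
  vertex_last : vertex (Fin.last (k + 1)) = L

namespace IntervalPartition

variable (T : IntervalPartition L)

/-- Reference edge length `ℓ₀(I)`. -/
def edgeLength (I : Fin (T.k + 1)) : ℝ := T.vertex I.succ - T.vertex I.castSucc

/-- The resolution `h(T)`, the maximal edge length. -/
def h : ℝ := ⨆ I : Fin (T.k + 1), T.edgeLength I

/-- The edge `I` as a compact interval. -/
def edge (I : Fin (T.k + 1)) : Set ℝ := Icc (T.vertex I.castSucc) (T.vertex I.succ)

/-- The midpoint of the edge `I`. -/
def midpoint (I : Fin (T.k + 1)) : ℝ := (T.vertex I.castSucc + T.vertex I.succ) / 2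

/-- The dual edge of the interior vertex `i`. -/
def dualEdge (i : Fin T.k) : Set ℝ := Icc (T.midpoint i.castSucc) (T.midpoint i.succ)

/-- Maps from the vertices of `T` to `ℝᵐ`. -/
abbrev Polygon (m : ℕ) : Type := Fin (T.k + 2) → E m

variable {T}

/-- Edge length `ℓ_P(I)` of the polygon `P`. -/
def Polygon.edgeLength (P : T.Polygon m) (I : Fin (T.k + 1)) : ℝ := ‖P I.succ - P I.castSucc‖

/-- Dual edge length of the polygon `P` at the interior vertex `i`. -/
def Polygon.dualLength (P : T.Polygon m) (i : Fin T.k) : ℝ :=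
  (P.edgeLength i.castSucc + P.edgeLength i.succ) / 2

/-- Discrete logarithmic strain `σ_P(I)`. -/
def Polygon.strain (P : T.Polygon m) (I : Fin (T.k + 1)) : ℝ :=
  Real.log (P.edgeLength I / T.edgeLength I)

/-- Unit edge vector `τ_P(I)`. -/
def Polygon.tangent (P : T.Polygon m) (I : Fin (T.k + 1)) : E m :=
  (P.edgeLength I)⁻¹ • (P I.succ - P I.castSucc)

/-- Discrete curvature vector `κ_P(i)`, the difference quotient of `τ_P`. -/
def Polygon.curvature (P : T.Polygon m) (i : Fin T.k) : E m :=
  (P.dualLength i)⁻¹ • (P.tangent i.succ - P.tangent i.castSucc)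

/-- Difference quotient of the discrete curvature along the interior edges. There are `k - 1` of
them; the `j`-th one is the edge `j + 1` and joins the interior vertices `j` and `j + 1`. -/
def Polygon.curvatureDeriv (P : T.Polygon m) (j : Fin (T.k - 1)) : E m :=
  (P.edgeLength ⟨j + 1, by omega⟩)⁻¹ •
    (P.curvature ⟨j + 1, by omega⟩ - P.curvature ⟨j, by omega⟩)

/-- Turning angle at the interior vertex `i`. -/
def Polygon.turningAngle (P : T.Polygon m) (i : Fin T.k) : ℝ :=
  InnerProductGeometry.angle (P.tangent i.castSucc) (P.tangent i.succ)

/-- The discrete Euler-Bernoulli energy. -/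
def Polygon.energy (P : T.Polygon m) : ℝ :=
  (1 / 2) * ∑ i : Fin T.k, P.turningAngle i ^ 2 / P.dualLength i

/-- The discrete seminorm `|P|_{w^{2,∞}_P}`, the maximum of `|κ_P|` over the interior vertices. -/
def Polygon.seminormW2Inf (P : T.Polygon m) : ℝ := ⨆ i : Fin T.k, ‖P.curvature i‖

/-- The discrete seminorm `|P|_{tv^3_P}`, the sum of `|D_P κ_P(I)| ℓ_P(I)` over the interior
edges `I`. -/
def Polygon.seminormTV3 (P : T.Polygon m) : ℝ :=
  ∑ j : Fin (T.k - 1), ‖P.curvatureDeriv j‖ * P.edgeLength ⟨j + 1, by omega⟩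

/-- The continuous, piecewise affine interpolation of the values of `P` at the vertices, written
as `P(0)` plus the increments of `P` along the edges, each weighted by the fraction of the edge
that lies to the left of `t`. -/
def Polygon.interp (P : T.Polygon m) (t : ℝ) : E m :=
  P 0 + ∑ I : Fin (T.k + 1),
    max 0 (min 1 ((t - T.vertex I.castSucc) / T.edgeLength I)) • (P I.succ - P I.castSucc)

/-- `P.interp` is affine on each edge and takes the values of `P` at its two vertices. -/
theorem Polygon.interp_of_mem_edge (P : T.Polygon m) (I : Fin (T.k + 1)) {t : ℝ}
    (ht : t ∈ T.edge I) :
    P.interp t = P I.castSucc +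
      ((t - T.vertex I.castSucc) / T.edgeLength I) • (P I.succ - P I.castSucc) := by
  have hpos : ∀ J : Fin (T.k + 1), 0 < T.edgeLength J := fun J =>
    sub_pos.2 (T.strictMono (Fin.castSucc_lt_succ (i := J)))
  have key : ∀ n : ℕ, ∀ hn : n < T.k + 2, P 0 + ∑ J : Fin (T.k + 1),
      (if J.val < n then P J.succ - P J.castSucc else 0) = P ⟨n, hn⟩ := by
    intro n
    induction n with
    | zero => intro hn; simp
    | succ n ih =>
      intro hn
      have hs : ∑ J : Fin (T.k + 1), (if J.val < n + 1 then P J.succ - P J.castSucc else 0) =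
          ∑ J : Fin (T.k + 1), (if J.val < n then P J.succ - P J.castSucc else 0) +
          ∑ J : Fin (T.k + 1), (if J = ⟨n, by omega⟩ then P J.succ - P J.castSucc else 0) := by
        rw [← Finset.sum_add_distrib]
        refine Finset.sum_congr rfl fun J _ => ?_
        by_cases h1 : J.val < n
        · simp [h1, Fin.ext_iff, h1.ne, Nat.lt_succ_of_lt h1]
        · by_cases h2 : J.val = n
          · simp [Fin.ext_iff, h2]
          · simp [Fin.ext_iff, h1, h2, show ¬ J.val < n + 1 by omega]
      rw [hs, ← add_assoc, ih (by omega)]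
      simp
  have hI := key I.val (by omega)
  have e : (⟨I.val, by omega⟩ : Fin (T.k + 2)) = I.castSucc := rfl
  rw [e] at hI
  rw [← hI, Polygon.interp, add_assoc]
  congr 1
  rw [hI]
  have hone : ((t - T.vertex I.castSucc) / T.edgeLength I) • (P I.succ - P I.castSucc) =
      ∑ J : Fin (T.k + 1), if J = I then
        ((t - T.vertex I.castSucc) / T.edgeLength I) • (P I.succ - P I.castSucc) else 0 := by
    simp
  rw [hone, ← Finset.sum_add_distrib]
  refine Finset.sum_congr rfl fun J _ => ?_
  rcases lt_trichotomy J I with h | h | h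
  · have h1 : T.vertex J.succ ≤ T.vertex I.castSucc := T.strictMono.monotone (by
      rw [Fin.le_def]; simpa using h)
    have h2 : 1 ≤ (t - T.vertex J.castSucc) / T.edgeLength J := by
      rw [le_div_iff₀ (hpos J), IntervalPartition.edgeLength]; linarith [ht.1]
    have h3 : J.val < I.val := h
    simp [h2, h3, h.ne]
  · subst h
    have h2 : (t - T.vertex J.castSucc) / T.edgeLength J ≤ 1 := by
      rw [div_le_iff₀ (hpos J), IntervalPartition.edgeLength]; linarith [ht.2]
    have h3 : 0 ≤ (t - T.vertex J.castSucc) / T.edgeLength J :=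
      div_nonneg (sub_nonneg.2 ht.1) (hpos J).le
    simp [h2, h3]
  · have h1 : T.vertex I.succ ≤ T.vertex J.castSucc := T.strictMono.monotone (by
      rw [Fin.le_def]; simpa using h)
    have h2 : (t - T.vertex J.castSucc) / T.edgeLength J ≤ 0 :=
      div_nonpos_of_nonpos_of_nonneg (by linarith [ht.2]) (hpos J).le
    have h3 : ¬ J.val < I.val := not_lt.2 (le_of_lt h)
    simp [h3, h.ne', h2]

variable (T)

/-- Discrete immersions: successive vertices are mapped to distinct points, i.e. the discrete
logarithmic strain is finite on every edge. -/
def config (m : ℕ) : Set (T.Polygon m) := {P | ∀ I : Fin (T.k + 1), P I.castSucc ≠ P I.succ}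

/-- The feasible set of discrete immersions that satisfy the boundary conditions and have
vanishing discrete logarithmic strain. -/
def feasible (B : BoundaryData m) : Set (T.Polygon m) :=
  {P | P ∈ T.config m ∧
    P 0 = B.startPoint ∧ P (Fin.last (T.k + 1)) = B.endPoint ∧
    P.tangent 0 = B.startTangent ∧ P.tangent (Fin.last T.k) = B.endTangent ∧
    ∀ I : Fin (T.k + 1), P.strain I = 0}

/-- The discrete a priori set. -/
def priors (B : BoundaryData m) (K₂ : ℝ) : Set (T.Polygon m) :=
  {P | P ∈ T.feasible B ∧ P.seminormW2Inf ≤ K₂ ∧ P.seminormTV3 ≤ K₂}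

end IntervalPartition

end Elastica

end

open Elastica

namespace Elastica

/-! A curve in the smooth a priori set has unit speed, so it is determined by its starting point and
its tangent `τ`, and `τ' = κ` is bounded and Lipschitz with constant `K₁`
(`exists_isTangentField_of_mem_smoothPriors`). A polygon without strain is likewise determined by
one unit vector per edge. Sampling `τ` at the edge midpoints, stretched affinely so that the outer
two fall on `0` and `L`, respects edge lengths and clamped tangents exactly. Only the closing
condition fails: `∑ ℓ_I τ(s_I)` misses the vector joining the end points by `O(h)`.

This defect is removed by normalizing `τ s + s (L - s) v`, with a single small vector `v` for the
whole curve; the weight vanishes at both ends. The resulting sum of edge vectors is a gradient as a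
function of `v`, so a suitable `v` is an interior minimizer of a potential (`exists_tilt_sum_eq`).
The minimizer in a ball of radius `O(h)` is interior because the quadratic form `∫ s (L - s) (‖v‖² -
⟪τ, v⟫²)` is bounded below uniformly over the admissible curves (`exists_coercivity`): if the end
points are closer than `L`, the tangent cannot stay near a fixed line. Otherwise the curve is
straight and `v = 0` works (`IsTangentField.eq_of_le_norm`).

Since `v = O(h)`, the tilted field is `O(h)`-close to `τ` together with its derivative, which stays
uniformly Lipschitz (`isApproxTangentField_tilt`). The discrete curvatures are difference quotients
of this field, their jumps are bounded by the gaps between sample points, which sum to `L`, and the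
discrete energy is a Riemann sum of `‖κ‖²` over the dual edges, up to an error from replacing angles
by chords. -/

theorem eqOn_Icc_of_ae_eq_intervalMeasure {F : Type*} [NormedAddCommGroup F] {L : ℝ} (hL : 0 < L) {u v : ℝ → F}
    (h : u =ᵐ[intervalMeasure L] v) (hu : ContinuousOn u (Icc 0 L))
    (hv : ContinuousOn v (Icc 0 L)) : EqOn u v (Icc 0 L) := by
  refine Measure.eqOn_Icc_of_ae_eq volume hL.ne ?_ hu hv
  rwa [← restrict_Ioo_eq_restrict_Icc]

/-- The choice inside `contRep` is immaterial on `[0, L]`: continuous functions that agree almost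
everywhere agree everywhere, end points included. -/
theorem contRep_eqOn {F : Type*} [NormedAddCommGroup F] {L : ℝ} (hL : 0 < L) {u v : ℝ → F} (h : u =ᵐ[intervalMeasure L] v)
    (hv : ContinuousOn v (Icc 0 L)) : EqOn (contRep L u) v (Icc 0 L) := by
  have hex : ∃ v : ℝ → F, ContinuousOn v (Icc 0 L) ∧ u =ᵐ[intervalMeasure L] v := ⟨v, hv, h⟩
  rw [contRep, dif_pos hex]
  exact eqOn_Icc_of_ae_eq_intervalMeasure hL (hex.choose_spec.2.symm.trans h) hex.choose_spec.1 hv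

/-! ### Weak derivatives on an interval and their primitives -/

section WeakDerivatives

variable {F : Type*} [NormedAddCommGroup F] [NormedSpace ℝ F] {L : ℝ}

theorem IsTestFunction.deriv {φ : ℝ → ℝ} (hφ : IsTestFunction L φ) :
    IsTestFunction L (deriv φ) :=
  ⟨((contDiff_infty_iff_deriv (f := φ)).1 hφ.1).2, hφ.2.1.deriv,
    (tsupport_deriv_subset (f := φ)).trans hφ.2.2⟩

theorem IsTestFunction.eq_zero_of_notMem {φ : ℝ → ℝ} (hφ : IsTestFunction L φ) {t : ℝ}
    (ht : t ∉ Ioo 0 L) : φ t = 0 :=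
  image_eq_zero_of_notMem_tsupport fun h => ht (hφ.2.2 h)

theorem IsTestFunction.integrableOn_smul {φ : ℝ → ℝ} (hφ : IsTestFunction L φ) {v : ℝ → F}
    (hv : LocallyIntegrableOn v (Ioo 0 L)) : IntegrableOn (fun t => φ t • v t) (Ioo 0 L) := by
  have hK : IsCompact (tsupport φ) := hφ.2.1
  have h := (hv.integrableOn_compact_subset hφ.2.2 hK).continuousOn_smul
    hφ.1.continuous.continuousOn hK
  refine h.of_forall_sdiff_eq_zero measurableSet_Ioo fun t ht => ?_
  rw [image_eq_zero_of_notMem_tsupport ht.2, zero_smul]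

theorem IsTestFunction.setIntegral_smul {φ : ℝ → ℝ} (hφ : IsTestFunction L φ) (v : ℝ → F) :
    ∫ t in Ioo 0 L, φ t • v t = ∫ t, φ t • v t :=
  setIntegral_eq_integral_of_forall_compl_eq_zero fun t ht => by
    rw [hφ.eq_zero_of_notMem ht, zero_smul]

/-- The fundamental lemma of the calculus of variations, from which uniqueness of weak derivatives
follows. -/
theorem LocallyIntegrableOn.ae_eq_of_integral_test_smul_eq [CompleteSpace F] {v w : ℝ → F}
    (hv : LocallyIntegrableOn v (Ioo 0 L)) (hw : LocallyIntegrableOn w (Ioo 0 L))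
    (h : ∀ φ, IsTestFunction L φ →
      ∫ t in Ioo 0 L, φ t • v t = ∫ t in Ioo 0 L, φ t • w t) :
    v =ᵐ[intervalMeasure L] w := by
  have key := isOpen_Ioo.ae_eq_zero_of_integral_contDiff_smul_eq_zero (hv.sub hw) (by
    intro g hg hgc hgs
    have hT : IsTestFunction L g := ⟨hg, hgc, hgs⟩
    rw [← hT.setIntegral_smul]
    simp only [Pi.sub_apply, smul_sub]
    rw [integral_sub (hT.integrableOn_smul hv) (hT.integrableOn_smul hw), h g hT, sub_self])
  rw [intervalMeasure, Filter.EventuallyEq, ae_restrict_iff' measurableSet_Ioo]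
  filter_upwards [key] with t ht h1
  exact sub_eq_zero.1 (ht h1)

theorem HasWeakDeriv.ae_unique [CompleteSpace F] {k : ℕ} {u v w : ℝ → F}
    (hv : HasWeakDeriv L k u v) (hw : HasWeakDeriv L k u w) : v =ᵐ[intervalMeasure L] w := by
  refine LocallyIntegrableOn.ae_eq_of_integral_test_smul_eq hv.2.1 hw.2.1 fun φ hφ => ?_
  have h := (hv.2.2 φ hφ).symm.trans (hw.2.2 φ hφ)
  exact smul_right_injective F (pow_ne_zero k (by norm_num : (-1 : ℝ) ≠ 0)) h

theorem hasWeakDeriv_weakDeriv {k : ℕ} {u : ℝ → F} (h : ∃ v, HasWeakDeriv L k u v) :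
    HasWeakDeriv L k u (weakDeriv L k u) := by
  rw [weakDeriv, dif_pos h]
  exact h.choose_spec

theorem HasWeakDeriv.weakDeriv_ae_eq [CompleteSpace F] {k : ℕ} {u v : ℝ → F}
    (h : HasWeakDeriv L k u v) : weakDeriv L k u =ᵐ[intervalMeasure L] v :=
  (hasWeakDeriv_weakDeriv ⟨v, h⟩).ae_unique h

/-- Test the identity of order `k` with `φ'`, the one of order `k + 1` with `φ`, and cancel `(-1) ^
k`. This reduces higher weak derivatives to a chain of first-order ones. -/
theorem HasWeakDeriv.succ {k : ℕ} {u v w : ℝ → F} (hv : HasWeakDeriv L k u v)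
    (hw : HasWeakDeriv L (k + 1) u w) : HasWeakDeriv L 1 v w := by
  refine ⟨hv.2.1, hw.2.1, fun φ hφ => ?_⟩
  have h1 := hv.2.2 _ hφ.deriv
  have h2 := hw.2.2 φ hφ
  rw [iteratedDeriv_succ'] at h2
  rw [h2, pow_succ, mul_smul] at h1
  have h3 := smul_right_injective F (pow_ne_zero k (by norm_num : (-1 : ℝ) ≠ 0)) h1
  rw [iteratedDeriv_one, ← h3, pow_one]

theorem hasWeakDeriv_zero {u : ℝ → F} (hu : LocallyIntegrableOn u (Ioo 0 L)) :
    HasWeakDeriv L 0 u u :=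
  ⟨hu, hu, fun φ _ => by simp⟩

theorem IsTestFunction.integral_deriv_eq_zero {φ : ℝ → ℝ} (hφ : IsTestFunction L φ) (hL : 0 < L) :
    ∫ t in Ioo 0 L, _root_.deriv φ t = 0 := by
  have h1 : ContDiff ℝ 1 φ := hφ.1.of_le (by exact_mod_cast le_top)
  rw [← integral_Ioc_eq_integral_Ioo, ← intervalIntegral.integral_of_le hL.le,
    intervalIntegral.integral_deriv_eq_sub' φ rfl (fun t _ => h1.differentiable (by simp) t)
      (h1.continuous_deriv le_rfl).continuousOn,
    hφ.eq_zero_of_notMem (by simp), hφ.eq_zero_of_notMem (by simp), sub_zero]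

theorem IsTestFunction.integral_deriv_Ioo {φ : ℝ → ℝ} (hφ : IsTestFunction L φ) {s : ℝ}
    (hs : s ∈ Ioo 0 L) : ∫ t in Ioo s L, _root_.deriv φ t = - φ s := by
  have h1 : ContDiff ℝ 1 φ := hφ.1.of_le (by exact_mod_cast le_top)
  rw [← integral_Ioc_eq_integral_Ioo, ← intervalIntegral.integral_of_le hs.2.le,
    intervalIntegral.integral_deriv_eq_sub' φ rfl (fun t _ => h1.differentiable (by simp) t)
      (h1.continuous_deriv le_rfl).continuousOn,
    hφ.eq_zero_of_notMem (t := L) (by simp), zero_sub]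

/-- Integration by parts against a primitive of an integrable function. -/
theorem IsTestFunction.integral_deriv_smul_primitive [CompleteSpace F] {φ : ℝ → ℝ}
    (hφ : IsTestFunction L φ) {v : ℝ → F} (hv : IntegrableOn v (Ioo 0 L)) :
    ∫ t in Ioo 0 L, _root_.deriv φ t • ∫ s in (0 : ℝ)..t, v s =
      - ∫ t in Ioo 0 L, φ t • v t := by
  have hd : IntegrableOn (_root_.deriv φ) (Ioo 0 L) :=
    (hφ.deriv.1.continuous.integrable_of_hasCompactSupport hφ.deriv.2.1).integrableOn
  -- Fubini on the triangle `s < t`: integrating `φ'` over `t ∈ (s, L)` first leaves `-φ s`.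
  have hset : MeasurableSet {z : ℝ × ℝ | z.2 < z.1} := measurableSet_lt measurable_snd measurable_fst
  have hint := (Integrable.smul_prod hd hv).indicator hset
  have hsw := integral_integral_swap
    (f := fun t s => {z : ℝ × ℝ | z.2 < z.1}.indicator
      (fun z : ℝ × ℝ => _root_.deriv φ z.1 • v z.2) (t, s)) hint
  have hl : ∀ t ∈ Ioo 0 L, ∫ s in Ioo 0 L, {z : ℝ × ℝ | z.2 < z.1}.indicator
      (fun z : ℝ × ℝ => _root_.deriv φ z.1 • v z.2) (t, s) =
      _root_.deriv φ t • ∫ s in (0 : ℝ)..t, v s := by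
    intro t ht
    have : ∀ s, {z : ℝ × ℝ | z.2 < z.1}.indicator
        (fun z : ℝ × ℝ => _root_.deriv φ z.1 • v z.2) (t, s) =
        (Iio t).indicator (fun s => _root_.deriv φ t • v s) s := fun s => by
      simp [Set.indicator]
    simp_rw [this]
    rw [setIntegral_indicator measurableSet_Iio, integral_smul, Ioo_inter_Iio, min_eq_right ht.2.le,
      ← integral_Ioc_eq_integral_Ioo, ← intervalIntegral.integral_of_le ht.1.le]
  have hr : ∀ s ∈ Ioo 0 L, ∫ t in Ioo 0 L, {z : ℝ × ℝ | z.2 < z.1}.indicator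
      (fun z : ℝ × ℝ => _root_.deriv φ z.1 • v z.2) (t, s) = - (φ s • v s) := by
    intro s hs
    have : ∀ t, {z : ℝ × ℝ | z.2 < z.1}.indicator
        (fun z : ℝ × ℝ => _root_.deriv φ z.1 • v z.2) (t, s) =
        (Ioi s).indicator (fun t => _root_.deriv φ t • v s) t := fun t => by
      simp [Set.indicator]
    simp_rw [this]
    rw [setIntegral_indicator measurableSet_Ioi, Ioo_inter_Ioi, max_eq_right hs.1.le,
      integral_smul_const, hφ.integral_deriv_Ioo hs, neg_smul]
  rw [setIntegral_congr_fun measurableSet_Ioo hl, setIntegral_congr_fun measurableSet_Ioo hr,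
    integral_neg] at hsw
  exact hsw

theorem continuousOn_primitive_of_integrableOn_Ioo (hL : 0 < L) {v : ℝ → F}
    (hv : IntegrableOn v (Ioo 0 L)) :
    ContinuousOn (fun t => ∫ s in (0 : ℝ)..t, v s) (Icc 0 L) := by
  rw [← uIcc_of_le hL.le]
  refine intervalIntegral.continuousOn_primitive_interval ?_
  rw [uIcc_of_le hL.le]
  exact (integrableOn_Icc_iff_integrableOn_Ioo (by simp) (by simp)).2 hv

theorem hasWeakDeriv_of_ae_eq_primitive [CompleteSpace F] (hL : 0 < L) {u v : ℝ → F}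
    (hv : IntegrableOn v (Ioo 0 L)) (c : F)
    (hu : u =ᵐ[intervalMeasure L] fun t => c + ∫ s in (0 : ℝ)..t, v s) :
    HasWeakDeriv L 1 u v := by
  have hcont := continuousOn_primitive_of_integrableOn_Ioo hL hv
  have hp : IntegrableOn (fun t => ∫ s in (0 : ℝ)..t, v s) (Ioo 0 L) :=
    hcont.integrableOn_Icc.mono_set Ioo_subset_Icc_self
  have hui : IntegrableOn u (Ioo 0 L) := by
    have : IntegrableOn (fun t => c + ∫ s in (0 : ℝ)..t, v s) (Ioo 0 L) :=
      (integrableOn_const (by simp)).add hp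
    exact Integrable.congr this hu.symm
  refine ⟨hui.locallyIntegrableOn, hv.locallyIntegrableOn, fun φ hφ => ?_⟩
  rw [iteratedDeriv_one, pow_one, neg_smul, one_smul, ← hφ.integral_deriv_smul_primitive hv]
  have h1 : ∫ t in Ioo 0 L, deriv φ t • u t =
      ∫ t in Ioo 0 L, (deriv φ t • c + deriv φ t • ∫ s in (0 : ℝ)..t, v s) := by
    refine integral_congr_ae ?_
    filter_upwards [hu] with t ht
    rw [ht, smul_add]
  rw [h1, integral_add, integral_smul_const, hφ.integral_deriv_eq_zero hL, zero_smul, zero_add]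
  · exact hφ.deriv.integrableOn_smul ((locallyIntegrable_const c).locallyIntegrableOn _)
  · exact hφ.deriv.integrableOn_smul hp.locallyIntegrableOn

/-- A primitive of a test function of mean zero is a test function. -/
theorem IsTestFunction.primitive {φ : ℝ → ℝ} (hφ : IsTestFunction L φ) (hL : 0 < L)
    (h0 : ∫ t in Ioo 0 L, φ t = 0) :
    ∃ ψ, IsTestFunction L ψ ∧ _root_.deriv ψ = φ := by
  have hd : ∀ t, HasDerivAt (fun t => ∫ s in (0 : ℝ)..t, φ s) (φ t) t := fun t =>
    intervalIntegral.integral_hasDerivAt_right (hφ.1.continuous.intervalIntegrable _ _)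
      (hφ.1.continuous.stronglyMeasurableAtFilter _ _) hφ.1.continuous.continuousAt
  have hde : _root_.deriv (fun t => ∫ s in (0 : ℝ)..t, φ s) = φ := funext fun t => (hd t).deriv
  -- The primitive vanishes to the left of `[a, b]` because `φ` does, and to the right because `φ`
  -- has mean zero; so it is supported in `[a, b]`.
  obtain ⟨a, b, ha, hb, hab⟩ : ∃ a b, 0 < a ∧ b < L ∧ tsupport φ ⊆ Icc a b := by
    rcases (tsupport φ).eq_empty_or_nonempty with h | h
    · exact ⟨L / 2, L / 2, by linarith, by linarith, by simp [h]⟩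
    · have hc : IsCompact (tsupport φ) := hφ.2.1
      exact ⟨_, _, (hφ.2.2 (hc.sInf_mem h)).1, (hφ.2.2 (hc.sSup_mem h)).2,
        subset_Icc_csInf_csSup hc.bddBelow hc.bddAbove⟩
  have hz : ∀ t, t ∉ Icc a b → φ t = 0 := fun t ht =>
    image_eq_zero_of_notMem_tsupport fun h => ht (hab h)
  have hsupp : ∀ t, t ∉ Icc a b → ∫ s in (0 : ℝ)..t, φ s = 0 := by
    intro t ht
    rw [mem_Icc, not_and_or, not_le, not_le] at ht
    rcases ht with ht | ht
    · refine (intervalIntegral.integral_congr (g := fun _ => 0) fun s hs => hz s fun h => ?_).trans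
        (by simp)
      have : s ≤ max 0 t := hs.2
      exact absurd h.1 (not_le.2 (this.trans_lt (max_lt ha ht)))
    · have h1 : ∫ s in (0 : ℝ)..L, φ s = 0 := by
        rw [intervalIntegral.integral_of_le hL.le, integral_Ioc_eq_integral_Ioo, h0]
      have h2 : ∫ s in L..t, φ s = 0 := by
        refine (intervalIntegral.integral_congr (g := fun _ => 0) fun s hs =>
          hz s fun h => ?_).trans (by simp)
        have : min L t ≤ s := hs.1
        exact absurd h.2 (not_le.2 ((lt_min hb ht).trans_le this))
      rw [← intervalIntegral.integral_add_adjacent_intervals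
        (hφ.1.continuous.intervalIntegrable 0 L) (hφ.1.continuous.intervalIntegrable L t), h1, h2,
        add_zero]
  have hts : tsupport (fun t => ∫ s in (0 : ℝ)..t, φ s) ⊆ Icc a b := by
    refine closure_minimal (fun t ht => ?_) isClosed_Icc
    by_contra h
    exact ht (hsupp t h)
  refine ⟨_, ⟨contDiff_infty_iff_deriv.2 ⟨fun t => (hd t).differentiableAt, ?_⟩,
    isCompact_Icc.of_isClosed_subset (isClosed_tsupport _) hts,
    hts.trans fun t ht => ⟨ha.trans_le ht.1, ht.2.trans_lt hb⟩⟩, hde⟩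
  rw [hde]; exact hφ.1

theorem exists_isTestFunction_integral_eq_one (hL : 0 < L) :
    ∃ ψ, IsTestFunction L ψ ∧ ∫ t in Ioo 0 L, ψ t = 1 := by
  let f : ContDiffBump (L / 2) := ⟨L / 8, L / 4, by positivity, by linarith⟩
  have hs : tsupport (f.normed volume) ⊆ Ioo 0 L := by
    rw [f.tsupport_normed_eq, Real.closedBall_eq_Icc]
    intro t ht
    have h4 : f.rOut = L / 4 := rfl
    rw [h4] at ht
    exact ⟨by linarith [ht.1], by linarith [ht.2]⟩
  have hT : IsTestFunction L (f.normed volume) :=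
    ⟨f.contDiff_normed, f.hasCompactSupport_normed, hs⟩
  refine ⟨_, hT, ?_⟩
  rw [setIntegral_eq_integral_of_forall_compl_eq_zero fun t ht => hT.eq_zero_of_notMem ht,
    f.integral_normed]

/-- The lemma of du Bois-Reymond. -/
theorem HasWeakDeriv.exists_ae_eq_const [CompleteSpace F] (hL : 0 < L) {u : ℝ → F}
    (h : HasWeakDeriv L 1 u 0) : ∃ c, u =ᵐ[intervalMeasure L] fun _ => c := by
  obtain ⟨ψ, hψ, hψ1⟩ := exists_isTestFunction_integral_eq_one hL
  -- With `a = ∫ φ`, the function `φ - a ψ` has mean zero, hence is the derivative of a test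
  -- function, and `u` integrates to zero against it. This identifies the constant as `∫ ψ u`.
  refine ⟨∫ t in Ioo 0 L, ψ t • u t, LocallyIntegrableOn.ae_eq_of_integral_test_smul_eq h.1
    ((locallyIntegrable_const _).locallyIntegrableOn _) fun φ hφ => ?_⟩
  rw [integral_smul_const]
  set a := ∫ t in Ioo 0 L, φ t with ha
  have hφi : IntegrableOn φ (Ioo 0 L) :=
    (hφ.1.continuous.integrable_of_hasCompactSupport hφ.2.1).integrableOn
  have hψi : IntegrableOn ψ (Ioo 0 L) :=
    (hψ.1.continuous.integrable_of_hasCompactSupport hψ.2.1).integrableOn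
  have hη : IsTestFunction L (fun t => φ t - a * ψ t) := by
    have hs : Function.support (fun t => φ t - a * ψ t) ⊆ tsupport φ ∪ tsupport ψ := by
      intro t ht
      by_contra hn
      rw [mem_union, not_or] at hn
      exact ht (by simp [image_eq_zero_of_notMem_tsupport hn.1,
        image_eq_zero_of_notMem_tsupport hn.2])
    have hc : IsCompact (tsupport φ ∪ tsupport ψ) := IsCompact.union hφ.2.1 hψ.2.1
    have hts := closure_minimal hs hc.isClosed
    exact ⟨hφ.1.sub (contDiff_const.mul hψ.1), hc.of_isClosed_subset (isClosed_tsupport _) hts,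
      hts.trans (union_subset hφ.2.2 hψ.2.2)⟩
  obtain ⟨χ, hχ, hχd⟩ := hη.primitive hL (by
    rw [integral_sub hφi (hψi.const_mul a), integral_const_mul, hψ1, ← ha]; ring)
  have h2 := h.2.2 χ hχ
  rw [iteratedDeriv_one, hχd] at h2
  simp only [Pi.zero_apply, smul_zero, integral_zero, sub_smul, mul_smul] at h2
  have h3 := integral_sub (hφ.integrableOn_smul h.1) ((hψ.integrableOn_smul h.1).smul a)
  simp only [Pi.smul_apply] at h3
  rwa [h3, integral_smul, sub_eq_zero] at h2

/-- Subtracting the primitive of `v` from `u` leaves a function with weak derivative zero, to which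
du Bois-Reymond applies. -/
theorem HasWeakDeriv.exists_ae_eq_primitive [CompleteSpace F] (hL : 0 < L) {u v : ℝ → F}
    (h : HasWeakDeriv L 1 u v) (hv : IntegrableOn v (Ioo 0 L)) :
    ∃ c, u =ᵐ[intervalMeasure L] fun t => c + ∫ s in (0 : ℝ)..t, v s := by
  have hp := hasWeakDeriv_of_ae_eq_primitive hL (u := fun t => ∫ s in (0 : ℝ)..t, v s) hv 0
    (by simp only [zero_add]; rfl)
  obtain ⟨c, hc⟩ := HasWeakDeriv.exists_ae_eq_const hL
    (u := fun t => u t - ∫ s in (0 : ℝ)..t, v s) ⟨h.1.sub hp.1,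
      (locallyIntegrable_const 0).locallyIntegrableOn _, fun φ hφ => by
        have h1 := h.2.2 φ hφ
        have h2 := hp.2.2 φ hφ
        rw [iteratedDeriv_one] at h1 h2 ⊢
        simp only [smul_sub, Pi.zero_apply, smul_zero, integral_zero]
        rw [integral_sub (hφ.deriv.integrableOn_smul h.1) (hφ.deriv.integrableOn_smul hp.1),
          h1, h2, sub_self]⟩
  refine ⟨c, ?_⟩
  filter_upwards [hc] with t ht
  rw [← ht, sub_add_cancel]

theorem ae_intervalMeasure_of_forall {P : ℝ → Prop} (h : ∀ t ∈ Ioo 0 L, P t) :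
    ∀ᵐ t ∂intervalMeasure L, P t :=
  ae_restrict_of_forall_mem measurableSet_Ioo h

theorem HasWeakDeriv.sobolevSeminorm_le [CompleteSpace F] {k : ℕ} {u v : ℝ → F} {c : ℝ}
    (h : HasWeakDeriv L k u v) (hc : ∀ᵐ t ∂intervalMeasure L, ‖v t‖ ≤ c) :
    sobolevSeminorm L k ⊤ u ≤ ENNReal.ofReal c := by
  rw [sobolevSeminorm, if_pos ⟨v, h⟩, eLpNorm_exponent_top]
  refine eLpNormEssSup_le_of_ae_bound ?_
  filter_upwards [hc, h.weakDeriv_ae_eq] with t h1 h2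
  rwa [h2]

theorem hasWeakDeriv_of_sobolevSeminorm_lt_top {k : ℕ} {p : ℝ≥0∞} {u : ℝ → F}
    (h : sobolevSeminorm L k p u < ⊤) : HasWeakDeriv L k u (weakDeriv L k u) := by
  rw [sobolevSeminorm] at h
  split_ifs at h with h1
  · exact hasWeakDeriv_weakDeriv h1
  · exact absurd h (lt_irrefl _)

theorem ae_norm_weakDeriv_le_of_sobolevSeminorm_le {k : ℕ} {K : ℝ≥0} {u : ℝ → F}
    (h : sobolevSeminorm L k ⊤ u ≤ K) :
    ∀ᵐ t ∂intervalMeasure L, ‖weakDeriv L k u t‖ ≤ K := by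
  rw [sobolevSeminorm] at h
  split_ifs at h with h1
  · rw [eLpNorm_exponent_top] at h
    filter_upwards [ae_le_eLpNormEssSup (f := weakDeriv L k u) (μ := intervalMeasure L)] with t ht
    have := ht.trans h
    rw [enorm_le_coe] at this
    exact_mod_cast this
  · simp at h

theorem HasWeakDeriv.integrableOn_of_ae_norm_le {k : ℕ} {u v : ℝ → F} {c : ℝ}
    (h : HasWeakDeriv L k u v) (hc : ∀ᵐ t ∂intervalMeasure L, ‖v t‖ ≤ c) :
    IntegrableOn v (Ioo 0 L) := by
  exact ⟨h.2.1.aestronglyMeasurable, .of_bounded hc⟩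

end WeakDerivatives

end Elastica

/-! ### Regularity of curves in the smooth a priori set -/

namespace Elastica

/-- A globally defined unit tangent field `τ` on `[0, L]` with Lipschitz derivative `κ`, matching
the boundary data `B`. -/
structure IsTangentField {m : ℕ} (L K : ℝ) (B : BoundaryData m) (τ κ : ℝ → E m) : Prop where
  hasDerivAt : ∀ t, HasDerivAt τ (κ t) t
  lipschitz : ∀ s t, ‖κ s - κ t‖ ≤ K * |s - t|
  norm_curvature_le : ∀ t, ‖κ t‖ ≤ K
  norm_eq_one : ∀ t ∈ Icc 0 L, ‖τ t‖ = 1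
  zero_eq : τ 0 = B.startTangent
  last_eq : τ L = B.endTangent
  integral_eq : ∫ t in (0 : ℝ)..L, τ t = B.endPoint - B.startPoint

theorem forall_Icc_of_ae_intervalMeasure {L : ℝ} (hL : 0 < L) {f : ℝ → ℝ} {c : ℝ}
    (hf : ContinuousOn f (Icc 0 L)) (h : ∀ᵐ t ∂intervalMeasure L, f t ≤ c) :
    ∀ t ∈ Icc 0 L, f t ≤ c := by
  intro t ht
  -- Written as `max f c = c`, the bound is an equality of continuous functions and passes from
  -- almost everywhere to everywhere.
  have h1 : (fun s => max (f s) c) =ᵐ[intervalMeasure L] fun _ => c := by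
    filter_upwards [h] with s hs using max_eq_right hs
  have h2 := eqOn_Icc_of_ae_eq_intervalMeasure hL h1 (ContinuousOn.sup hf continuousOn_const)
    continuousOn_const ht
  exact max_eq_right_iff.1 h2

variable {m : ℕ} {L : ℝ}

/-- Curves in the smooth a priori set are twice differentiable with Lipschitz second derivative. -/
theorem exists_isTangentField_of_mem_smoothPriors (hL : 0 < L) {p : ℝ≥0∞} {B : BoundaryData m}
    {K₁ : ℝ≥0} {γ : Curve m L} (hγ : γ ∈ smoothPriors hL p B K₁) :
    ∃ τ κ : ℝ → E m, IsTangentField L K₁ B τ κ ∧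
      (∀ t ∈ Icc 0 L, γ.extend hL t = B.startPoint + ∫ s in (0 : ℝ)..t, τ s) ∧
      velocity hL γ =ᵐ[intervalMeasure L] τ ∧
      ∀ t ∈ Icc 0 L, curvature hL γ t = κ t := by
  obtain ⟨⟨⟨⟨hW1, hne, -⟩, -⟩, h0, hLast, hτ0, hτL, hσ⟩, hK2, hK3⟩ := hγ
  have hs1 : sobolevSeminorm L 1 ⊤ (γ.extend hL) < ⊤ :=
    lt_of_le_of_lt (Finset.single_le_sum (f := fun j => sobolevSeminorm L j ⊤ (γ.extend hL))
      (fun _ _ => zero_le) (by simp : 1 ∈ Finset.range 2)) hW1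
  have hd1 := hasWeakDeriv_of_sobolevSeminorm_lt_top hs1
  have hd2 := hasWeakDeriv_of_sobolevSeminorm_lt_top (hK2.trans_lt ENNReal.coe_lt_top)
  have hd3 := hasWeakDeriv_of_sobolevSeminorm_lt_top (hK3.trans_lt ENNReal.coe_lt_top)
  have hb2 := ae_norm_weakDeriv_le_of_sobolevSeminorm_le hK2
  have hb3 := ae_norm_weakDeriv_le_of_sobolevSeminorm_le hK3
  -- `Real.log` also vanishes at `0` and `-1`; these are excluded by `γ' ≠ 0` and by positivity of
  -- the norm.
  have hb1 : ∀ᵐ t ∂intervalMeasure L, ‖weakDeriv L 1 (γ.extend hL) t‖ = 1 := by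
    filter_upwards [hne, hσ] with t h1 h2
    have h3 : Real.log ‖velocity hL γ t‖ = 0 := h2
    have h4 : ‖velocity hL γ t‖ ≠ 0 := norm_ne_zero_iff.2 h1
    rcases Real.log_eq_zero.1 h3 with h | h | h
    · exact absurd h h4
    · exact h
    · linarith [norm_nonneg (velocity hL γ t)]
  set v1 := weakDeriv L 1 (γ.extend hL) with hv1
  set v2 := weakDeriv L 2 (γ.extend hL)
  set v3 := weakDeriv L 3 (γ.extend hL)
  have hi1 := hd1.integrableOn_of_ae_norm_le (hb1.mono fun _ h => h.le)
  have hi2 := hd2.integrableOn_of_ae_norm_le hb2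
  have hi3 := hd3.integrableOn_of_ae_norm_le hb3
  -- Integrating back from order three: the second derivative is a Lipschitz primitive, the first a
  -- primitive of that, and `γ` a primitive of the first.
  obtain ⟨c3, hc3⟩ := (hd2.succ hd3).exists_ae_eq_primitive hL hi3
  obtain ⟨c2, hc2⟩ := (hd1.succ hd2).exists_ae_eq_primitive hL hi2
  obtain ⟨c1, hc1⟩ := hd1.exists_ae_eq_primitive hL hi1
  have hii : ∀ {v : ℝ → E m}, IntegrableOn v (Ioo 0 L) → ∀ {a b}, a ∈ Icc 0 L → b ∈ Icc 0 L →
      IntervalIntegrable v volume a b := by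
    intro v hv a b ha hb
    have : IntegrableOn v (Icc 0 L) := (integrableOn_Icc_iff_integrableOn_Ioo (by simp) (by simp)).2 hv
    exact (this.mono_set (uIcc_subset_Icc ha hb)).intervalIntegrable
  have hsub : ∀ {a b}, a ∈ Icc 0 L → b ∈ Icc 0 L → uIoc a b ⊆ Ioc 0 L := by
    intro a b ha hb x hx
    rw [uIoc, mem_Ioc] at hx
    exact ⟨(le_min ha.1 hb.1).trans_lt hx.1, hx.2.trans (max_le ha.2 hb.2)⟩
  have hcongr : ∀ {v w : ℝ → E m}, v =ᵐ[intervalMeasure L] w → ∀ {a b}, a ∈ Icc 0 L →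
      b ∈ Icc 0 L → ∫ s in a..b, v s = ∫ s in a..b, w s := by
    intro v w hvw a b ha hb
    refine intervalIntegral.integral_congr_ae ?_
    rw [intervalMeasure, Measure.restrict_congr_set Ioo_ae_eq_Ioc, Filter.EventuallyEq,
      ae_restrict_iff' measurableSet_Ioc] at hvw
    filter_upwards [hvw] with t ht hts using ht (hsub ha hb hts)
  have hz : (0 : ℝ) ∈ Icc 0 L := ⟨le_rfl, hL.le⟩
  set k0 : ℝ → E m := fun t => c3 + ∫ s in (0 : ℝ)..t, v3 s with hk0
  have hk0c : ContinuousOn k0 (Icc 0 L) :=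
    continuousOn_const.add (continuousOn_primitive_of_integrableOn_Ioo hL hi3)
  have hk0l : ∀ a ∈ Icc 0 L, ∀ b ∈ Icc 0 L, ‖k0 a - k0 b‖ ≤ K₁ * |a - b| := by
    intro a ha b hb
    simp only [hk0, add_sub_add_left_eq_sub]
    rw [intervalIntegral.integral_interval_sub_left (hii hi3 hz ha) (hii hi3 hz hb)]
    refine intervalIntegral.norm_integral_le_of_norm_le_const_ae ?_
    rw [intervalMeasure, Measure.restrict_congr_set Ioo_ae_eq_Ioc,
      ae_restrict_iff' measurableSet_Ioc] at hb3
    filter_upwards [hb3] with t ht hts using ht (hsub hb ha hts)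
  have hk0b : ∀ t ∈ Icc 0 L, ‖k0 t‖ ≤ K₁ := by
    refine forall_Icc_of_ae_intervalMeasure hL hk0c.norm ?_
    filter_upwards [hc3, hb2] with t h1 h2
    rwa [← h1]
  set κ : ℝ → E m := fun t => k0 (projIcc 0 L hL.le t) with hκ
  have hκe : ∀ t ∈ Icc 0 L, κ t = k0 t := fun t ht => by simp [hκ, projIcc_of_mem hL.le ht]
  have hκl : ∀ s t, ‖κ s - κ t‖ ≤ K₁ * |s - t| := fun s t =>
    (hk0l _ (projIcc 0 L hL.le s).2 _ (projIcc 0 L hL.le t).2).trans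
      (mul_le_mul_of_nonneg_left (abs_projIcc_sub_projIcc hL.le) K₁.2)
  have hκc : Continuous κ := by
    have : LipschitzWith K₁ κ := LipschitzWith.of_dist_le_mul fun s t => by
      rw [dist_eq_norm, Real.dist_eq]; exact hκl s t
    exact this.continuous
  have hv2κ : v2 =ᵐ[intervalMeasure L] κ := by
    filter_upwards [hc3, ae_intervalMeasure_of_forall fun t ht => hκe t (Ioo_subset_Icc_self ht)]
      with t h1 h2
    rw [h1, h2]
  set τ : ℝ → E m := fun t => c2 + ∫ s in (0 : ℝ)..t, κ s with hτ
  have hτd : ∀ t, HasDerivAt τ (κ t) t := fun t =>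
    (intervalIntegral.integral_hasDerivAt_right (hκc.intervalIntegrable _ _)
      (hκc.stronglyMeasurableAtFilter _ _) hκc.continuousAt).const_add c2
  have hτc : Continuous τ := continuous_iff_continuousAt.2 fun t => (hτd t).continuousAt
  have hv1τ : v1 =ᵐ[intervalMeasure L] τ := by
    filter_upwards [hc2, ae_intervalMeasure_of_forall fun t ht =>
      hcongr hv2κ hz (Ioo_subset_Icc_self ht)] with t h1 h2
    rw [h1, h2]
  have hγc : Continuous (γ.extend hL) := γ.continuous.Icc_extend'
  have hγτ0 : ∀ t ∈ Icc 0 L, γ.extend hL t = c1 + ∫ s in (0 : ℝ)..t, τ s := by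
    refine eqOn_Icc_of_ae_eq_intervalMeasure hL ?_ hγc.continuousOn
      (continuousOn_const.add (continuousOn_primitive_of_integrableOn_Ioo hL
        (hτc.integrableOn_Icc.mono_set Ioo_subset_Icc_self)))
    filter_upwards [hc1, ae_intervalMeasure_of_forall fun t ht =>
      hcongr hv1τ hz (Ioo_subset_Icc_self ht)] with t h1 h2
    rw [h1, h2]
  have hc1q : c1 = B.startPoint := by
    have := hγτ0 0 hz
    rw [h0] at this
    simpa using this.symm
  have hunit : ∀ t ∈ Icc 0 L, ‖τ t‖ = 1 := by
    refine eqOn_Icc_of_ae_eq_intervalMeasure (v := fun _ => (1 : ℝ)) hL ?_ hτc.norm.continuousOn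
      continuousOn_const
    filter_upwards [hb1, hv1τ] with t h1 h2
    rw [← h2, h1]
  have hut : EqOn (unitTangent hL γ) τ (Icc 0 L) := by
    refine contRep_eqOn hL ?_ hτc.continuousOn
    filter_upwards [hb1, hv1τ] with t h1 h2
    have h3 : velocity hL γ t = τ t := h2
    have h4 : ‖velocity hL γ t‖ = 1 := h1
    rw [h4, h3, inv_one, one_smul]
  have hutd : HasWeakDeriv L 1 (unitTangent hL γ) κ := by
    refine hasWeakDeriv_of_ae_eq_primitive hL
      (hκc.integrableOn_Icc.mono_set Ioo_subset_Icc_self) c2 ?_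
    filter_upwards [ae_intervalMeasure_of_forall fun t ht => hut (Ioo_subset_Icc_self ht)] with t h
    rw [h]
  have hcurv : EqOn (curvature hL γ) κ (Icc 0 L) := by
    refine contRep_eqOn hL ?_ hκc.continuousOn
    filter_upwards [hb1, hutd.weakDeriv_ae_eq] with t h1 h2
    have h4 : ‖velocity hL γ t‖ = 1 := h1
    rw [h4, h2, inv_one, one_smul]
  refine ⟨τ, κ, ⟨hτd, hκl, fun t => hk0b _ (projIcc 0 L hL.le t).2, hunit, ?_, ?_, ?_⟩, ?_, hv1τ,
    hcurv⟩
  · rw [← hτ0, hut hz]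
  · rw [← hτL, hut ⟨hL.le, le_rfl⟩]
  · rw [← hLast, hγτ0 L ⟨hL.le, le_rfl⟩, hc1q, add_sub_cancel_left]
  · intro t ht
    rw [hγτ0 t ht, hc1q]

end Elastica

/-! ### Normalization of vectors and the tilting potential -/

namespace Elastica

theorem abs_inv_norm_sub_inv_norm_le {V : Type*} [NormedAddCommGroup V] {y z : V} (hy : 1 / 2 ≤ ‖y‖) (hz : 1 / 2 ≤ ‖z‖) :
    |‖y‖⁻¹ - ‖z‖⁻¹| ≤ 4 * ‖y - z‖ := by
  have hy0 : 0 < ‖y‖ := by linarith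
  have hz0 : 0 < ‖z‖ := by linarith
  rw [inv_sub_inv hy0.ne' hz0.ne', abs_div, abs_of_pos (mul_pos hy0 hz0),
    div_le_iff₀ (mul_pos hy0 hz0), abs_sub_comm]
  have h1 := abs_norm_sub_norm_le y z
  have h2 : 1 / 4 ≤ ‖y‖ * ‖z‖ := by nlinarith
  nlinarith [norm_nonneg (y - z)]

section Normalization

open scoped RealInnerProductSpace

variable {V : Type*} [NormedAddCommGroup V] [InnerProductSpace ℝ V]

theorem hasDerivAt_norm_of_ne_zero {y : ℝ → V} {y' : V} {s : ℝ} (hy : HasDerivAt y y' s)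
    (h0 : y s ≠ 0) : HasDerivAt (fun t => ‖y t‖) (‖y s‖⁻¹ * ⟪y s, y'⟫) s := by
  have h := (hy.norm_sq).sqrt (pow_ne_zero 2 (norm_ne_zero_iff.2 h0))
  simp only [Real.sqrt_sq (norm_nonneg _)] at h
  convert h using 1
  field_simp

/-- The differential of `y ↦ ‖y‖⁻¹ • y`, applied to `z`. -/
noncomputable def normalizeDeriv (y z : V) : V := ‖y‖⁻¹ • (z - ⟪‖y‖⁻¹ • y, z⟫ • (‖y‖⁻¹ • y))

theorem hasDerivAt_normalize {y : ℝ → V} {y' : V} {s : ℝ} (hy : HasDerivAt y y' s)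
    (h0 : y s ≠ 0) : HasDerivAt (fun t => ‖y t‖⁻¹ • y t) (normalizeDeriv (y s) y') s := by
  have hn := norm_ne_zero_iff.2 h0
  have h := ((hasDerivAt_norm_of_ne_zero hy h0).inv hn).smul hy
  refine h.congr_deriv ?_
  rw [normalizeDeriv, real_inner_smul_left, smul_sub, smul_smul, smul_smul, sub_eq_add_neg,
    ← neg_smul]
  congr 2
  field_simp

theorem norm_inv_smul_self {y : V} (h0 : y ≠ 0) : ‖‖y‖⁻¹ • y‖ = 1 := by
  rw [norm_smul, norm_inv, norm_norm, inv_mul_cancel₀ (norm_ne_zero_iff.2 h0)]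

theorem norm_normalize_sub_normalize_le {y z : V} (hy : 1 / 2 ≤ ‖y‖) (hz : 1 / 2 ≤ ‖z‖) :
    ‖‖y‖⁻¹ • y - ‖z‖⁻¹ • z‖ ≤ 4 * ‖y - z‖ := by
  have hy0 : 0 < ‖y‖ := by linarith
  have hz0 : 0 < ‖z‖ := by linarith
  -- Beside `y - z`, the bracket contains a multiple of `z` of length `|‖z‖ - ‖y‖|`, at most `‖y -
  -- z‖`; together with `‖y‖⁻¹ ≤ 2` this gives the factor 4.
  have e : ‖y‖⁻¹ • y - ‖z‖⁻¹ • z = ‖y‖⁻¹ • ((y - z) + ((‖z‖ - ‖y‖) * ‖z‖⁻¹) • z) := by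
    rw [smul_add, smul_sub, smul_smul, ← mul_assoc, mul_sub, sub_mul, inv_mul_cancel₀ hy0.ne',
      one_mul, sub_smul, mul_assoc, mul_inv_cancel₀ hz0.ne', mul_one]
    abel
  rw [e, norm_smul, norm_inv, norm_norm]
  have h1 := abs_norm_sub_norm_le z y
  rw [norm_sub_rev z y] at h1
  have h2 : ‖(y - z) + ((‖z‖ - ‖y‖) * ‖z‖⁻¹) • z‖ ≤ 2 * ‖y - z‖ := by
    refine (norm_add_le _ _).trans ?_
    rw [norm_smul, norm_mul, norm_inv, norm_norm, mul_assoc, inv_mul_cancel₀ hz0.ne', mul_one,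
      Real.norm_eq_abs]
    linarith
  have h3 : ‖y‖⁻¹ ≤ 2 := by
    rw [inv_le_comm₀ hy0 two_pos]; linarith
  calc _ ≤ 2 * (2 * ‖y - z‖) := mul_le_mul h3 h2 (norm_nonneg _) two_pos.le
    _ = _ := by ring

theorem norm_normalizeDeriv_sub_le {y₁ y₂ z₁ z₂ : V} (h₁ : 1 / 2 ≤ ‖y₁‖) (h₂ : 1 / 2 ≤ ‖y₂‖) :
    ‖normalizeDeriv y₁ z₁ - normalizeDeriv y₂ z₂‖ ≤
      4 * ‖z₁ - z₂‖ + 24 * ‖y₁ - y₂‖ * ‖z₂‖ := by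
  have hp₁ : 0 < ‖y₁‖ := by linarith
  have hp₂ : 0 < ‖y₂‖ := by linarith
  have hu₁ := norm_inv_smul_self (norm_pos_iff.1 hp₁)
  have hu₂ := norm_inv_smul_self (norm_pos_iff.1 hp₂)
  have hu := norm_normalize_sub_normalize_le h₁ h₂
  have hn := abs_inv_norm_sub_inv_norm_le h₁ h₂
  have hi : ‖y₁‖⁻¹ ≤ 2 := by rw [inv_le_comm₀ hp₁ two_pos]; linarith
  have hi0 : 0 ≤ ‖y₁‖⁻¹ := inv_nonneg.2 hp₁.le
  unfold normalizeDeriv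
  generalize ‖y₁‖⁻¹ • y₁ = u₁ at *
  generalize ‖y₂‖⁻¹ • y₂ = u₂ at *
  generalize ‖y₁‖⁻¹ = n₁ at *
  generalize ‖y₂‖⁻¹ = n₂ at *
  -- The changes of `z`, of the unit direction and of the scalar factor are separated. The last two
  -- contribute `16` and `8` to the constant `24`.
  have e : n₁ • (z₁ - ⟪u₁, z₁⟫ • u₁) - n₂ • (z₂ - ⟪u₂, z₂⟫ • u₂) =
      n₁ • (((z₁ - z₂) - ⟪u₁, z₁ - z₂⟫ • u₁) -
        (⟪u₁, z₂⟫ • (u₁ - u₂) + ⟪u₁ - u₂, z₂⟫ • u₂)) +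
      (n₁ - n₂) • (z₂ - ⟪u₂, z₂⟫ • u₂) := by
    simp only [inner_sub_right, inner_sub_left]
    module
  have hin : ∀ u z : V, ‖u‖ = 1 → ‖z - ⟪u, z⟫ • u‖ ≤ 2 * ‖z‖ := fun u z h => by
    refine (norm_sub_le _ _).trans ?_
    rw [norm_smul, h, mul_one]
    have := norm_inner_le_norm (𝕜 := ℝ) u z
    rw [h, one_mul] at this
    linarith
  have hA := hin u₁ (z₁ - z₂) hu₁
  have hB := hin u₂ z₂ hu₂
  have hC : ‖⟪u₁, z₂⟫ • (u₁ - u₂) + ⟪u₁ - u₂, z₂⟫ • u₂‖ ≤ 8 * ‖y₁ - y₂‖ * ‖z₂‖ := by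
    refine (norm_add_le _ _).trans ?_
    rw [norm_smul, norm_smul, hu₂, mul_one]
    have h3 := norm_inner_le_norm (𝕜 := ℝ) u₁ z₂
    have h4 := norm_inner_le_norm (𝕜 := ℝ) (u₁ - u₂) z₂
    rw [hu₁, one_mul] at h3
    have h5 := mul_le_mul h3 hu (norm_nonneg _) (norm_nonneg _)
    have h6 := mul_le_mul_of_nonneg_right hu (norm_nonneg z₂)
    linarith
  rw [e]
  refine (norm_add_le _ _).trans ?_
  rw [norm_smul, norm_smul, Real.norm_of_nonneg hi0, Real.norm_eq_abs]
  have hD : n₁ * ‖((z₁ - z₂) - ⟪u₁, z₁ - z₂⟫ • u₁) -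
        (⟪u₁, z₂⟫ • (u₁ - u₂) + ⟪u₁ - u₂, z₂⟫ • u₂)‖ ≤
      2 * (2 * ‖z₁ - z₂‖ + 8 * ‖y₁ - y₂‖ * ‖z₂‖) :=
    mul_le_mul hi ((norm_sub_le _ _).trans (add_le_add hA hC)) (norm_nonneg _) two_pos.le
  have hE := mul_le_mul hn hB (norm_nonneg _) (by positivity)
  linarith

theorem normalizeDeriv_of_norm_eq_one {y z : V} (hy : ‖y‖ = 1) (hyz : ⟪y, z⟫ = 0) :
    normalizeDeriv y z = z := by
  simp [normalizeDeriv, hy, hyz]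

/-- The potential whose gradient in `v` is the normalization of `u + w • v`. -/
noncomputable def tiltPotential (w : ℝ) (u v : V) : ℝ :=
  if w = 0 then ⟪u, v⟫ else (‖u + w • v‖ - 1) / w

theorem tiltPotential_zero_right {w : ℝ} {u : V} (hu : ‖u‖ = 1) : tiltPotential w u 0 = 0 := by
  simp [tiltPotential, hu]

theorem continuous_tiltPotential (w : ℝ) (u : V) : Continuous (tiltPotential w u) := by
  unfold tiltPotential
  split_ifs <;> fun_prop

theorem add_smul_norm_bounds {w : ℝ} {u v : V} (hu : ‖u‖ = 1) (hw : 0 ≤ w)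
    (hwv : w * ‖v‖ ≤ 1 / 2) : 1 / 2 ≤ ‖u + w • v‖ ∧ ‖u + w • v‖ ≤ 3 / 2 := by
  have h1 : ‖w • v‖ ≤ 1 / 2 := by rwa [norm_smul, Real.norm_of_nonneg hw]
  have h2 := norm_sub_norm_le u (-(w • v))
  have h3 := norm_add_le u (w • v)
  rw [sub_neg_eq_add, norm_neg] at h2
  constructor <;> linarith

/-- Differentiating the norm produces a factor `w`, which the division in the potential cancels. For
`w = 0`, the weight at both ends of the curve, the linear function is the limit of the quotients and
its gradient `u` is already normalized. -/
theorem hasDerivAt_tiltPotential {w : ℝ} {u v : V} (hu : ‖u‖ = 1) (hw : 0 ≤ w)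
    (hwv : w * ‖v‖ ≤ 1 / 2) (e : V) :
    HasDerivAt (fun t : ℝ => tiltPotential w u (v + t • e))
      ⟪‖u + w • v‖⁻¹ • (u + w • v), e⟫ 0 := by
  have hlin : HasDerivAt (fun t : ℝ => v + t • e) e 0 := by
    simpa using ((hasDerivAt_id (0 : ℝ)).smul_const e).const_add v
  unfold tiltPotential
  split_ifs with h
  · subst h
    simpa [hu] using (hasDerivAt_const (0 : ℝ) u).inner ℝ hlin
  · have h1 : HasDerivAt (fun t : ℝ => u + w • (v + t • e)) (w • e) 0 :=
      (hlin.const_smul w).const_add u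
    have hne : u + w • (v + (0 : ℝ) • e) ≠ 0 := by
      rw [zero_smul, add_zero, ← norm_pos_iff]
      linarith [(add_smul_norm_bounds hu hw hwv).1]
    have h2 := ((hasDerivAt_norm_of_ne_zero h1 hne).sub_const 1).div_const w
    refine h2.congr_deriv ?_
    rw [zero_smul, add_zero, real_inner_smul_left, real_inner_smul_right]
    field_simp

/-- With `N = ‖u + w • v‖` and `x = ⟪u, v⟫`, the product of `N - (1 + w x)` and `N + (1 + w x)` is
`w² (‖v‖² - x²)`, and the second factor is at most 4. The gain over the linear part thus comes from
the component of `v` orthogonal to `u`. -/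
theorem le_tiltPotential {w : ℝ} {u v : V} (hu : ‖u‖ = 1) (hw : 0 ≤ w)
    (hwv : w * ‖v‖ ≤ 1 / 2) :
    ⟪u, v⟫ + w / 4 * (‖v‖ ^ 2 - ⟪u, v⟫ ^ 2) ≤ tiltPotential w u v := by
  unfold tiltPotential
  split_ifs with h
  · simp [h]
  · have hw' : 0 < w := lt_of_le_of_ne hw (Ne.symm h)
    obtain ⟨h1, h2⟩ := add_smul_norm_bounds hu hw hwv
    have hsq : ‖u + w • v‖ ^ 2 = 1 + 2 * w * ⟪u, v⟫ + w ^ 2 * ‖v‖ ^ 2 := by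
      rw [norm_add_sq_real, hu, norm_smul, real_inner_smul_right, Real.norm_of_nonneg hw]; ring
    have hx : |⟪u, v⟫| ≤ ‖v‖ := by simpa [hu] using abs_real_inner_le_norm u v
    rw [le_div_iff₀ hw']
    set N := ‖u + w • v‖
    set x := ⟪u, v⟫
    have hx1 : w * x ≤ 1 / 2 := (mul_le_mul_of_nonneg_left ((le_abs_self x).trans hx) hw).trans hwv
    have hx2 : -(1 / 2) ≤ w * x := by
      have := mul_le_mul_of_nonneg_left ((neg_le_abs x).trans hx) hw
      linarith
    have hb : 0 ≤ w ^ 2 * (‖v‖ ^ 2 - x ^ 2) :=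
      mul_nonneg (sq_nonneg _) (sub_nonneg.2 (sq_le_sq' (neg_le_of_abs_le hx) (le_of_abs_le hx)))
    have hmul : (N - (1 + w * x)) * (N + (1 + w * x)) = w ^ 2 * (‖v‖ ^ 2 - x ^ 2) := by
      linear_combination hsq
    have hge : 0 ≤ N - (1 + w * x) := by
      by_contra hneg
      push Not at hneg
      have : 0 < N + (1 + w * x) := by linarith
      nlinarith [mul_neg_of_neg_of_pos hneg this]
    have hle : N + (1 + w * x) ≤ 4 := by linarith
    nlinarith [mul_le_mul_of_nonneg_left hle hge]

/-- Unit vectors can be tilted in a common direction `v` such that a prescribed weighted sum `d` is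
attained, if the weighted sum is close to `d` and the weights are coercive. -/
theorem exists_tilt_sum_eq [FiniteDimensional ℝ V] {ι : Type*} [Fintype ι] {ℓ w : ι → ℝ}
    {u : ι → V} {d : V} {c ε r : ℝ} (hℓ : ∀ i, 0 ≤ ℓ i) (hw : ∀ i, 0 ≤ w i)
    (hu : ∀ i, ‖u i‖ = 1) (hr : 0 < r) (hwr : ∀ i, w i * r ≤ 1 / 2)
    (hd : ‖∑ i, ℓ i • u i - d‖ ≤ ε)
    (hc : ∀ v : V, c * ‖v‖ ^ 2 ≤ ∑ i, ℓ i * (w i * (‖v‖ ^ 2 - ⟪u i, v⟫ ^ 2)))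
    (hε : 4 * ε < c * r) :
    ∃ v : V, ‖v‖ ≤ r ∧ ∑ i, ℓ i • (‖u i + w i • v‖⁻¹ • (u i + w i • v)) = d := by
  have hwv : ∀ v : V, ‖v‖ ≤ r → ∀ i, w i * ‖v‖ ≤ 1 / 2 := fun v hv i =>
    (mul_le_mul_of_nonneg_left hv (hw i)).trans (hwr i)
  -- The gradient of `Φ` at `v` is the defect of the closing condition, so an interior critical
  -- point is a solution.
  set Φ : V → ℝ := fun v => ∑ i, ℓ i * tiltPotential (w i) (u i) v - ⟪d, v⟫ with hΦ
  have hΦc : Continuous Φ :=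
    (continuous_finsetSum _ fun i _ =>
      continuous_const.mul (continuous_tiltPotential (w i) (u i))).sub (by fun_prop)
  have hΦ0 : Φ 0 = 0 := by simp [hΦ, tiltPotential_zero_right (hu _)]
  obtain ⟨v, hv, hmin⟩ := (isCompact_closedBall (0 : V) r).exists_isMinOn
    ⟨0, by simp [hr.le]⟩ hΦc.continuousOn
  have hvr : ‖v‖ ≤ r := by simpa using hv
  -- On the sphere of radius `r`, `Φ` is at least `-ε r + c r² / 4 > 0 = Φ 0`, so the minimum is not
  -- attained there.
  have hlt : ‖v‖ < r := by
    refine lt_of_le_of_ne hvr fun heq => ?_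
    have h1 : Φ v ≤ 0 := hΦ0 ▸ hmin (by simp [hr.le])
    have h2 : ∑ i, ℓ i * (⟪u i, v⟫ + w i / 4 * (‖v‖ ^ 2 - ⟪u i, v⟫ ^ 2)) ≤
        ∑ i, ℓ i * tiltPotential (w i) (u i) v :=
      Finset.sum_le_sum fun i _ => mul_le_mul_of_nonneg_left
        (le_tiltPotential (hu i) (hw i) (hwv v hvr i)) (hℓ i)
    have h3 : ∑ i, ℓ i * (⟪u i, v⟫ + w i / 4 * (‖v‖ ^ 2 - ⟪u i, v⟫ ^ 2)) =
        ⟪∑ i, ℓ i • u i, v⟫ + 1 / 4 * ∑ i, ℓ i * (w i * (‖v‖ ^ 2 - ⟪u i, v⟫ ^ 2)) := by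
      rw [sum_inner, Finset.mul_sum, ← Finset.sum_add_distrib]
      refine Finset.sum_congr rfl fun i _ => ?_
      rw [real_inner_smul_left]; ring
    have h4 : -(ε * r) ≤ ⟪∑ i, ℓ i • u i, v⟫ - ⟪d, v⟫ := by
      rw [← inner_sub_left]
      have := (abs_real_inner_le_norm (∑ i, ℓ i • u i - d) v).trans
        (mul_le_mul hd heq.le (norm_nonneg _) ((norm_nonneg _).trans hd))
      exact neg_le_of_abs_le this
    have h5 := hc v
    rw [heq] at h5 h2 h3
    have h6 : 4 * ε * r < c * r ^ 2 := by nlinarith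
    simp only [hΦ] at h1
    linarith
  refine ⟨v, hvr, ?_⟩
  rw [← sub_eq_zero, ← inner_self_eq_zero (𝕜 := ℝ)]
  set g := ∑ i, ℓ i • (‖u i + w i • v‖⁻¹ • (u i + w i • v)) - d with hg
  -- Differentiating at the minimizer in the direction of the defect `g` itself gives `⟪g, g⟫ = 0`.
  have hder : HasDerivAt (fun t : ℝ => Φ (v + t • g)) ⟪g, g⟫ 0 := by
    have h1 : HasDerivAt (fun t : ℝ => ∑ i, ℓ i * tiltPotential (w i) (u i) (v + t • g))
        (∑ i, ℓ i * ⟪‖u i + w i • v‖⁻¹ • (u i + w i • v), g⟫) 0 :=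
      HasDerivAt.fun_sum fun i _ =>
        (hasDerivAt_tiltPotential (hu i) (hw i) (hwv v hvr i) g).const_mul (ℓ i)
    have h2 : HasDerivAt (fun t : ℝ => ⟪d, v + t • g⟫) ⟪d, g⟫ 0 := by
      have hlin : HasDerivAt (fun t : ℝ => v + t • g) g 0 := by
        simpa using ((hasDerivAt_id (0 : ℝ)).smul_const g).const_add v
      simpa using (hasDerivAt_const (0 : ℝ) d).inner ℝ hlin
    refine (h1.sub h2).congr_deriv ?_
    conv_rhs => rw [hg, inner_sub_left, sum_inner]
    simp only [real_inner_smul_left, hg]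
  have hloc : IsLocalMin (fun t : ℝ => Φ (v + t • g)) 0 := by
    have hcont : Filter.Tendsto (fun t : ℝ => v + t • g) (nhds 0) (nhds v) := by
      have : Continuous fun t : ℝ => v + t • g := by fun_prop
      simpa using this.tendsto 0
    have hev : ∀ᶠ x in nhds v, x ∈ Metric.closedBall (0 : V) r :=
      Filter.mem_of_superset (Metric.isOpen_ball.mem_nhds (by simpa using hlt))
        Metric.ball_subset_closedBall
    filter_upwards [hcont.eventually hev] with t ht
    simpa using hmin ht
  exact hloc.hasDerivAt_eq_zero hder

end Normalization

end Elastica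

/-! ### Coercivity: the tangent leaves every fixed direction -/

namespace Elastica

section Coercivity

open scoped RealInnerProductSpace

theorem abs_sq_inner_sub_sq_inner_le {V : Type*} [NormedAddCommGroup V] [InnerProductSpace ℝ V]
    {x y v : V} (hx : ‖x‖ = 1) (hy : ‖y‖ = 1) :
    |⟪x, v⟫ ^ 2 - ⟪y, v⟫ ^ 2| ≤ 2 * ‖x - y‖ * ‖v‖ ^ 2 := by
  have h1 : ⟪x, v⟫ ^ 2 - ⟪y, v⟫ ^ 2 = ⟪x - y, v⟫ * ⟪x + y, v⟫ := by
    rw [inner_sub_left, inner_add_left]; ring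
  have h2 : ‖x + y‖ ≤ 2 := (norm_add_le x y).trans (by rw [hx, hy]; norm_num)
  rw [h1, abs_mul]
  calc _ ≤ (‖x - y‖ * ‖v‖) * (2 * ‖v‖) :=
        mul_le_mul (abs_real_inner_le_norm _ _) ((abs_real_inner_le_norm _ _).trans
          (mul_le_mul_of_nonneg_right h2 (norm_nonneg _))) (abs_nonneg _) (by positivity)
    _ = _ := by ring

variable {V : Type*} [NormedAddCommGroup V] [InnerProductSpace ℝ V] [CompleteSpace V]

/-- Otherwise `⟪τ, v⟫` never vanishes, so by continuity it keeps its sign and, after replacing `v`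
by `-v` if needed, exceeds `μ ‖v‖` throughout. Integration then contradicts Cauchy–Schwarz. -/
theorem exists_sq_inner_le_of_norm_integral_lt {L μ : ℝ} (hL : 0 < L) (hμ : 0 < μ) {τ : ℝ → V}
    (hτ : Continuous τ) (hint : ‖∫ t in (0 : ℝ)..L, τ t‖ < L * μ) (v : V) :
    ∃ t ∈ Icc 0 L, ⟪τ t, v⟫ ^ 2 ≤ μ ^ 2 * ‖v‖ ^ 2 := by
  by_contra! hcon
  have hv : 0 < ‖v‖ := by
    rw [norm_pos_iff]
    rintro rfl
    simpa using hcon 0 ⟨le_rfl, hL.le⟩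
  have key : ∀ w : V, ‖w‖ = ‖v‖ → (∀ t ∈ Icc 0 L, μ ^ 2 * ‖v‖ ^ 2 < ⟪τ t, w⟫ ^ 2) →
      0 < ⟪τ 0, w⟫ → False := by
    intro w hw hsq h0
    have hcont : Continuous fun t => ⟪τ t, w⟫ := hτ.inner continuous_const
    have hpos : ∀ t ∈ Icc 0 L, 0 < ⟪τ t, w⟫ := by
      intro t ht
      by_contra! hle
      obtain ⟨s, hs, hs0⟩ := intermediate_value_Icc' ht.1 hcont.continuousOn
        (show (0 : ℝ) ∈ Icc ⟪τ t, w⟫ ⟪τ 0, w⟫ from ⟨hle, h0.le⟩)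
      have := hsq s ⟨hs.1, hs.2.trans ht.2⟩
      simp only at hs0
      rw [hs0] at this
      have h2 : 0 ≤ μ ^ 2 * ‖v‖ ^ 2 := by positivity
      linarith [zero_pow (M₀ := ℝ) two_ne_zero]
    have hge : ∀ t ∈ Icc 0 L, μ * ‖v‖ ≤ ⟪τ t, w⟫ := by
      intro t ht
      have h1 := hsq t ht
      rw [← mul_pow] at h1
      exact (abs_lt_of_sq_lt_sq h1 (hpos t ht).le |> le_of_abs_le ∘ le_of_lt)
    have h1 : ∫ t in (0 : ℝ)..L, ⟪τ t, w⟫ = ⟪∫ t in (0 : ℝ)..L, τ t, w⟫ := by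
      have := (innerSL ℝ w).intervalIntegral_comp_comm (hτ.intervalIntegrable (μ := volume) 0 L)
      simp only [innerSL_apply_apply] at this
      simp only [real_inner_comm w]
      exact this
    have h2 : ∫ t in (0 : ℝ)..L, μ * ‖v‖ ≤ ∫ t in (0 : ℝ)..L, ⟪τ t, w⟫ :=
      intervalIntegral.integral_mono_on hL.le (by simp) (hcont.intervalIntegrable 0 L) hge
    rw [h1, intervalIntegral.integral_const, sub_zero, smul_eq_mul] at h2
    have h3 := real_inner_le_norm (∫ t in (0 : ℝ)..L, τ t) w
    rw [hw] at h3
    nlinarith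
  have h0 := hcon 0 ⟨le_rfl, hL.le⟩
  rcases lt_trichotomy ⟪τ 0, v⟫ 0 with h | h | h
  · exact key (-v) (norm_neg v) (by simpa using hcon) (by simpa using h)
  · rw [h] at h0
    have h2 : 0 ≤ μ ^ 2 * ‖v‖ ^ 2 := by positivity
    linarith [zero_pow (M₀ := ℝ) two_ne_zero]
  · exact key v rfl hcon h

/-- If the end points are closer than `L`, then the tangent field of a curve of length `L` with
curvature at most `K` moves away from every fixed direction by a definite amount. -/
theorem exists_coercivity {L K : ℝ} (hL : 0 < L) (hK : 0 ≤ K) {a : ℝ} (ha0 : 0 ≤ a) (ha : a < L) :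
    ∃ c : ℝ, 0 < c ∧ ∀ τ : ℝ → V, Continuous τ → (∀ t ∈ Icc 0 L, ‖τ t‖ = 1) →
      (∀ s ∈ Icc 0 L, ∀ t ∈ Icc 0 L, ‖τ s - τ t‖ ≤ K * |s - t|) →
      ‖∫ t in (0 : ℝ)..L, τ t‖ ≤ a → ∀ v : V,
      c * ‖v‖ ^ 2 ≤ ∫ s in (0 : ℝ)..L, s * (L - s) * (‖v‖ ^ 2 - ⟪τ s, v⟫ ^ 2) := by
  -- Any `μ` strictly between `a / L` and `1` would do: `a < L μ` yields a point where `τ` deviates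
  -- from the line of `v`, and `δ = 1 - μ ^ 2` measures the deviation.
  set μ := (a / L + 1) / 2 with hμ
  have haL : a / L < 1 := (div_lt_one hL).2 ha
  have haL0 : 0 ≤ a / L := div_nonneg ha0 hL.le
  have hμ0 : 0 < μ := by rw [hμ]; positivity
  have hμ1 : μ < 1 := by rw [hμ]; linarith
  have haμ : a < L * μ := by
    have : a = L * (a / L) := by field_simp
    rw [hμ]; nlinarith
  set δ := 1 - μ ^ 2 with hδ
  have hδ0 : 0 < δ := by rw [hδ]; nlinarith
  -- Within distance `ρ` of that point `τ` moves by at most `δ / 4`, so half of the deviation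
  -- survives.
  set ρ := min (L / 2) (δ / (4 * (K + 1))) with hρ
  have hρ0 : 0 < ρ := lt_min (by positivity) (by positivity)
  have hρL : ρ ≤ L / 2 := min_le_left _ _
  have hρδ : ρ * (4 * (K + 1)) ≤ δ := (le_div_iff₀ (by positivity)).1 (min_le_right _ _)
  refine ⟨(ρ / 3) * ((ρ / 3) ^ 2 * (δ / 2)), by positivity, fun τ hτ h1 hlip hint v => ?_⟩
  obtain ⟨t, ht, htv⟩ := exists_sq_inner_le_of_norm_integral_lt hL hμ0 hτ (hint.trans_lt haμ) v
  obtain ⟨b, hb0, hbL, hbt1, hbt2⟩ : ∃ b, 0 ≤ b ∧ b + ρ ≤ L ∧ b ≤ t ∧ t ≤ b + ρ := by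
    rcases le_total t (L / 2) with h | h
    · exact ⟨t, ht.1, by linarith, le_rfl, by linarith⟩
    · exact ⟨t - ρ, by linarith, by linarith [ht.2], by linarith, by linarith⟩
  -- The middle third of `[b, b + ρ]` stays `ρ / 3` away from `0` and `L`, which keeps the weight `s
  -- (L - s)` above `(ρ / 3) ^ 2`.
  have hbound : ∀ s ∈ Icc (b + ρ / 3) (b + 2 * ρ / 3),
      (ρ / 3) ^ 2 * (δ / 2) * ‖v‖ ^ 2 ≤ s * (L - s) * (‖v‖ ^ 2 - ⟪τ s, v⟫ ^ 2) := by
    intro s hs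
    have hs0 : s ∈ Icc 0 L := ⟨by linarith [hs.1], by linarith [hs.2]⟩
    have hst : |s - t| ≤ ρ := abs_le.2 ⟨by linarith [hs.1], by linarith [hs.2]⟩
    have h3 := (abs_sq_inner_sub_sq_inner_le (v := v) (h1 s hs0) (h1 t ht))
    have h4 : ‖τ s - τ t‖ ≤ δ / 4 := by
      have := (hlip s hs0 t ht).trans (mul_le_mul_of_nonneg_left hst hK)
      nlinarith
    have h5 : 2 * ‖τ s - τ t‖ * ‖v‖ ^ 2 ≤ δ / 2 * ‖v‖ ^ 2 := by
      refine mul_le_mul_of_nonneg_right ?_ (sq_nonneg _); linarith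
    have h6 : δ / 2 * ‖v‖ ^ 2 ≤ ‖v‖ ^ 2 - ⟪τ s, v⟫ ^ 2 := by
      have h7 := (le_abs_self _).trans h3
      have h8 : δ * ‖v‖ ^ 2 = ‖v‖ ^ 2 - μ ^ 2 * ‖v‖ ^ 2 := by rw [hδ]; ring
      linarith
    have h9 : (ρ / 3) ^ 2 ≤ s * (L - s) := by
      rw [sq]
      exact mul_le_mul (by linarith [hs.1]) (by linarith [hs.2]) (by positivity) hs0.1
    rw [mul_assoc]
    exact mul_le_mul h9 h6 (by positivity) (mul_nonneg hs0.1 (sub_nonneg.2 hs0.2))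
  have hcont : Continuous fun s => s * (L - s) * (‖v‖ ^ 2 - ⟪τ s, v⟫ ^ 2) := by fun_prop
  have hsub : ∫ s in (b + ρ / 3)..(b + 2 * ρ / 3), s * (L - s) * (‖v‖ ^ 2 - ⟪τ s, v⟫ ^ 2) ≤
      ∫ s in (0 : ℝ)..L, s * (L - s) * (‖v‖ ^ 2 - ⟪τ s, v⟫ ^ 2) := by
    refine intervalIntegral.integral_mono_interval (by linarith) (by linarith) (by linarith) ?_
      (hcont.intervalIntegrable _ _)
    refine ae_restrict_of_forall_mem measurableSet_Ioc fun s hs => ?_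
    have hs0 : s ∈ Icc 0 L := Ioc_subset_Icc_self hs
    refine mul_nonneg (mul_nonneg hs0.1 (sub_nonneg.2 hs0.2)) (sub_nonneg.2 ?_)
    have := abs_real_inner_le_norm (τ s) v
    rw [h1 s hs0, one_mul] at this
    exact sq_le_sq' (neg_le_of_abs_le this) (le_of_abs_le this)
  refine le_trans ?_ hsub
  have := intervalIntegral.integral_mono_on (μ := volume) (by linarith) (by simp)
    (hcont.intervalIntegrable (b + ρ / 3) (b + 2 * ρ / 3)) hbound
  rw [intervalIntegral.integral_const, smul_eq_mul] at this
  refine le_trans (le_of_eq ?_) this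
  ring

end Coercivity

/-! ### Telescoping sums and Riemann sums -/

section FinSums

theorem sum_succ_sub_castSucc {A : Type*} [AddCommGroup A] {n : ℕ} (f : Fin (n + 1) → A) :
    ∑ i : Fin n, (f i.succ - f i.castSucc) = f (Fin.last n) - f 0 := by
  induction n with
  | zero => simp
  | succ n ih =>
    rw [Fin.sum_univ_castSucc]
    have := ih (fun i => f i.castSucc)
    simp only [← Fin.succ_castSucc] at this
    rw [this, Fin.succ_last, Fin.castSucc_zero]
    abel

theorem sum_integral_castSucc_succ {F : Type*} [NormedAddCommGroup F] [NormedSpace ℝ F]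
    {n : ℕ} (x : Fin (n + 1) → ℝ) {g : ℝ → F} (hg : Continuous g) :
    ∑ i : Fin n, ∫ t in x i.castSucc..x i.succ, g t = ∫ t in x 0..x (Fin.last n), g t := by
  have h : ∀ a b, ∫ t in a..b, g t = (∫ t in (0 : ℝ)..b, g t) - ∫ t in (0 : ℝ)..a, g t :=
    fun a b => (intervalIntegral.integral_interval_sub_left (hg.intervalIntegrable _ _)
      (hg.intervalIntegrable _ _)).symm
  simp only [h (x _) (x _)]
  exact sum_succ_sub_castSucc (fun i => ∫ t in (0 : ℝ)..x i, g t)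

/-- The nodes are arbitrary because two quadratures are needed: over the edges for closing up and
coercivity, and over the dual edges for the energy. -/
theorem norm_sum_smul_sub_integral_le {F : Type*} [NormedAddCommGroup F] [NormedSpace ℝ F]
    [CompleteSpace F] {n : ℕ} {x : Fin (n + 1) → ℝ} (hx : Monotone x) {g : ℝ → F}
    (hg : Continuous g) {c : Fin n → F} {η : ℝ}
    (hc : ∀ i : Fin n, ∀ t ∈ Icc (x i.castSucc) (x i.succ), ‖c i - g t‖ ≤ η) :
    ‖∑ i : Fin n, (x i.succ - x i.castSucc) • c i - ∫ t in x 0..x (Fin.last n), g t‖ ≤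
      η * (x (Fin.last n) - x 0) := by
  rw [← sum_integral_castSucc_succ x hg, ← Finset.sum_sub_distrib,
    ← sum_succ_sub_castSucc x, Finset.mul_sum]
  refine (norm_sum_le _ _).trans (Finset.sum_le_sum fun i _ => ?_)
  have hle : x i.castSucc ≤ x i.succ := hx (Fin.castSucc_lt_succ (i := i)).le
  rw [← intervalIntegral.integral_const, ← intervalIntegral.integral_sub (by simp)
    (hg.intervalIntegrable _ _)]
  refine (intervalIntegral.norm_integral_le_of_norm_le_const fun t ht => hc i t ?_).trans_eq ?_
  · rw [uIoc_of_le hle] at ht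
    exact Ioc_subset_Icc_self ht
  · rw [abs_of_nonneg (sub_nonneg.2 hle)]

end FinSums

/-! ### Partitions and rescaled midpoints -/

namespace IntervalPartition

variable {L : ℝ} (T : IntervalPartition L)

theorem edgeLength_pos (I : Fin (T.k + 1)) : 0 < T.edgeLength I :=
  sub_pos.2 (T.strictMono (Fin.castSucc_lt_succ (i := I)))

theorem edgeLength_le_h (I : Fin (T.k + 1)) : T.edgeLength I ≤ T.h :=
  le_ciSup (f := T.edgeLength) (Set.finite_range _).bddAbove I

theorem h_pos : 0 < T.h := (T.edgeLength_pos 0).trans_le (T.edgeLength_le_h 0)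

theorem sum_edgeLength : ∑ I, T.edgeLength I = L := by
  have := sum_succ_sub_castSucc T.vertex
  rwa [T.vertex_zero, T.vertex_last, sub_zero] at this

theorem vertex_mem (n : Fin (T.k + 2)) : T.vertex n ∈ Icc 0 L :=
  ⟨T.vertex_zero.symm.le.trans (T.strictMono.monotone (Fin.zero_le n)),
    (T.strictMono.monotone (Fin.le_last n)).trans T.vertex_last.le⟩

theorem edge_subset (I : Fin (T.k + 1)) : T.edge I ⊆ Icc 0 L := fun _ ht =>
  ⟨(T.vertex_mem _).1.trans ht.1, ht.2.trans (T.vertex_mem _).2⟩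

theorem castSucc_vertex_add_edgeLength (I : Fin (T.k + 1)) :
    T.vertex I.succ = T.vertex I.castSucc + T.edgeLength I := by
  rw [edgeLength]; ring

theorem midpoint_zero : T.midpoint 0 = T.edgeLength 0 / 2 := by
  rw [midpoint, castSucc_vertex_add_edgeLength, Fin.castSucc_zero, T.vertex_zero]; ring

theorem midpoint_last : T.midpoint (Fin.last T.k) = L - T.edgeLength (Fin.last T.k) / 2 := by
  have : T.vertex (Fin.last T.k).succ = L := T.vertex_last
  rw [midpoint, edgeLength, this]; ring

theorem midpoint_succ_sub (i : Fin T.k) : T.midpoint i.succ - T.midpoint i.castSucc =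
    (T.edgeLength i.castSucc + T.edgeLength i.succ) / 2 := by
  rw [midpoint, midpoint, edgeLength, edgeLength, Fin.succ_castSucc]; ring

theorem midpoint_strictMono : StrictMono T.midpoint := by
  refine Fin.strictMono_iff_lt_succ.2 fun i => ?_
  have := T.midpoint_succ_sub i
  linarith [T.edgeLength_pos i.castSucc, T.edgeLength_pos i.succ]

theorem k_pos_of_h_lt (h : T.h < L) : 0 < T.k := by
  by_contra hk
  have h0 : T.k = 0 := by omega
  have hs := T.sum_edgeLength
  have : ∀ I : Fin (T.k + 1), I = 0 := fun I => Fin.ext (by have := I.2; simp; omega)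
  rw [Finset.sum_eq_single_of_mem (0 : Fin (T.k + 1)) (Finset.mem_univ _)
    fun b _ hb => absurd (this b) hb] at hs
  linarith [T.edgeLength_le_h 0]

/-- The distance between the midpoints of the first and the last edge. -/
noncomputable def midpointSpan : ℝ := T.midpoint (Fin.last T.k) - T.midpoint 0

/-- The midpoints of the edges, affinely rescaled such that the first one becomes `0` and the last
one becomes `L`. -/
noncomputable def samplePoint (I : Fin (T.k + 1)) : ℝ := L / T.midpointSpan * (T.midpoint I - T.midpoint 0)

theorem midpointSpan_eq :
    T.midpointSpan = L - (T.edgeLength 0 + T.edgeLength (Fin.last T.k)) / 2 := by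
  rw [midpointSpan, midpoint_last, midpoint_zero]; ring

theorem midpointSpan_ge : L - T.h ≤ T.midpointSpan := by
  rw [midpointSpan_eq]
  linarith [T.edgeLength_le_h 0, T.edgeLength_le_h (Fin.last T.k)]

theorem samplePoint_zero : T.samplePoint 0 = 0 := by simp [samplePoint]

/-- The rescaling is affine, so sample gaps and dual lengths have the same ratio at every interior
vertex. Discrete curvatures are therefore difference quotients of the sampled field up to one common
factor. -/
theorem samplePoint_succ_sub (i : Fin T.k) : T.samplePoint i.succ - T.samplePoint i.castSucc =
    L / T.midpointSpan * (T.midpoint i.succ - T.midpoint i.castSucc) := by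
  rw [samplePoint, samplePoint]; ring

variable {T}

theorem length_pos_of_h_le (hh : T.h ≤ L / 2) : 0 < L := by linarith [T.h_pos]

theorem midpointSpan_pos (hh : T.h ≤ L / 2) : 0 < T.midpointSpan := by
  linarith [T.midpointSpan_ge, length_pos_of_h_le hh]

theorem samplePoint_last (hh : T.h ≤ L / 2) : T.samplePoint (Fin.last T.k) = L := by
  have := (midpointSpan_pos hh).ne'
  rw [samplePoint, ← midpointSpan]; field_simp

theorem length_div_midpointSpan_le (hh : T.h ≤ L / 2) : L / T.midpointSpan ≤ 2 := by
  rw [div_le_iff₀ (midpointSpan_pos hh)]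
  linarith [T.midpointSpan_ge]

theorem one_le_length_div_midpointSpan (hh : T.h ≤ L / 2) : 1 ≤ L / T.midpointSpan := by
  rw [le_div_iff₀ (midpointSpan_pos hh), midpointSpan_eq]
  linarith [T.edgeLength_pos 0, T.edgeLength_pos (Fin.last T.k)]

theorem length_div_midpointSpan_sub_one_le (hh : T.h ≤ L / 2) : L / T.midpointSpan - 1 ≤ 2 / L * T.h := by
  have hL := length_pos_of_h_le hh
  have hs := midpointSpan_pos hh
  have h1 : L / T.midpointSpan - 1 = (L - T.midpointSpan) / T.midpointSpan := by
    field_simp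
  rw [h1, div_mul_eq_mul_div, div_le_div_iff₀ hs hL]
  nlinarith [T.midpointSpan_ge, T.h_pos]

theorem samplePoint_strictMono (hh : T.h ≤ L / 2) : StrictMono T.samplePoint := fun I J hIJ => by
  have h1 := T.midpoint_strictMono hIJ
  have h2 : 0 < L / T.midpointSpan := div_pos (length_pos_of_h_le hh) (midpointSpan_pos hh)
  unfold samplePoint
  exact mul_lt_mul_of_pos_left (by linarith) h2

theorem samplePoint_mem (hh : T.h ≤ L / 2) (I : Fin (T.k + 1)) : T.samplePoint I ∈ Icc 0 L :=
  ⟨T.samplePoint_zero.symm.le.trans ((samplePoint_strictMono hh).monotone (Fin.zero_le I)),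
    ((samplePoint_strictMono hh).monotone (Fin.le_last I)).trans (samplePoint_last hh).le⟩

/-- The displacement is an affine function of the midpoint and runs from minus half the first edge
to plus half the last edge. -/
theorem abs_samplePoint_sub_midpoint_le (hh : T.h ≤ L / 2) (I : Fin (T.k + 1)) :
    |T.samplePoint I - T.midpoint I| ≤ T.h / 2 := by
  have hs := midpointSpan_pos hh
  have hm0 : T.midpoint 0 ≤ T.midpoint I := T.midpoint_strictMono.monotone (Fin.zero_le I)
  have hm1 : T.midpoint I ≤ T.midpoint (Fin.last T.k) :=
    T.midpoint_strictMono.monotone (Fin.le_last I)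
  set l := (T.midpoint I - T.midpoint 0) / T.midpointSpan with hl
  have hl0 : 0 ≤ l := div_nonneg (sub_nonneg.2 hm0) hs.le
  have hl1 : l ≤ 1 := (div_le_one hs).2 (by rw [midpointSpan]; linarith)
  have hlm : l * T.midpointSpan = T.midpoint I - T.midpoint 0 := div_mul_cancel₀ _ hs.ne'
  have e : T.samplePoint I - T.midpoint I =
      l * (L - T.midpoint (Fin.last T.k)) - (1 - l) * T.midpoint 0 := by
    have e1 : T.samplePoint I = L * l := by rw [samplePoint, hl]; ring
    rw [e1]
    rw [midpointSpan] at hlm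
    linear_combination hlm
  have h0 := T.midpoint_zero
  have h1 := T.midpoint_last
  have h2 := T.edgeLength_le_h 0
  have h3 := T.edgeLength_le_h (Fin.last T.k)
  have h4 := T.edgeLength_pos 0
  have h5 := T.edgeLength_pos (Fin.last T.k)
  rw [e, abs_le]
  constructor <;> nlinarith

theorem abs_samplePoint_sub_le (hh : T.h ≤ L / 2) (I : Fin (T.k + 1)) {t : ℝ} (ht : t ∈ T.edge I) :
    |T.samplePoint I - t| ≤ T.h := by
  have h1 := abs_le.1 (abs_samplePoint_sub_midpoint_le hh I)
  have h2 := T.edgeLength_le_h I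
  rw [edge, mem_Icc, castSucc_vertex_add_edgeLength] at ht
  rw [midpoint, castSucc_vertex_add_edgeLength] at h1
  rw [abs_le]
  constructor <;> linarith

end IntervalPartition

end Elastica

/-! ### Tilting the tangent field to close up the polygon -/

namespace Elastica

open scoped RealInnerProductSpace

theorem abs_mul_sub_sub_mul_sub_le {L s t : ℝ} (hs : s ∈ Icc 0 L) (ht : t ∈ Icc 0 L) :
    |s * (L - s) - t * (L - t)| ≤ L * |s - t| := by
  have e : s * (L - s) - t * (L - t) = (L - s - t) * (s - t) := by ring
  rw [e, abs_mul]
  refine mul_le_mul_of_nonneg_right (abs_le.2 ⟨?_, ?_⟩) (abs_nonneg _) <;>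
    linarith [hs.1, hs.2, ht.1, ht.2]

theorem mul_sub_mem {L s : ℝ} (hs : s ∈ Icc 0 L) : 0 ≤ s * (L - s) ∧ s * (L - s) ≤ L ^ 2 :=
  ⟨mul_nonneg hs.1 (sub_nonneg.2 hs.2), by nlinarith [hs.1, hs.2]⟩

variable {m : ℕ} {L K : ℝ} {B : BoundaryData m} {τ κ : ℝ → E m}

namespace IsTangentField

theorem continuous (h : IsTangentField L K B τ κ) : Continuous τ :=
  continuous_iff_continuousAt.2 fun t => (h.hasDerivAt t).continuousAt

theorem norm_sub_le (h : IsTangentField L K B τ κ) (s t : ℝ) : ‖τ s - τ t‖ ≤ K * |s - t| :=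
  convex_univ.norm_image_sub_le_of_norm_hasDerivWithin_le
    (fun x _ => (h.hasDerivAt x).hasDerivWithinAt) (fun x _ => h.norm_curvature_le x)
    (mem_univ t) (mem_univ s)

theorem bound_nonneg (h : IsTangentField L K B τ κ) : 0 ≤ K :=
  (norm_nonneg _).trans (h.norm_curvature_le 0)

theorem continuous_curvature (h : IsTangentField L K B τ κ) : Continuous κ := by
  have : LipschitzWith ⟨K, h.bound_nonneg⟩ κ := LipschitzWith.of_dist_le_mul fun s t => by
    rw [dist_eq_norm, Real.dist_eq]; exact h.lipschitz s t
  exact this.continuous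

/-- Differentiate `‖τ‖ ^ 2 = 1` in the open interval, where it holds near each point, and pass to
the end points by continuity. -/
theorem inner_eq_zero (h : IsTangentField L K B τ κ) (hL : 0 < L) :
    ∀ t ∈ Icc 0 L, ⟪τ t, κ t⟫ = 0 := by
  have hIoo : ∀ t ∈ Ioo 0 L, ⟪τ t, κ t⟫ = 0 := by
    intro t ht
    have h1 := (h.hasDerivAt t).norm_sq
    have h2 : HasDerivAt (fun s => ‖τ s‖ ^ 2) 0 t := by
      refine (hasDerivAt_const t (1 : ℝ)).congr_of_eventuallyEq ?_
      filter_upwards [Ioo_mem_nhds ht.1 ht.2] with s hs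
      rw [h.norm_eq_one s (Ioo_subset_Icc_self hs), one_pow]
    have h3 := h1.unique h2
    linarith
  exact eqOn_Icc_of_ae_eq_intervalMeasure (v := fun _ => (0 : ℝ)) hL
    (ae_intervalMeasure_of_forall hIoo)
    (h.continuous.inner h.continuous_curvature).continuousOn continuousOn_const

/-- If the end points have distance at least `L`, then the tangent is constant. -/
theorem eq_of_le_norm (h : IsTangentField L K B τ κ) (hL : 0 < L)
    (hd : L ≤ ‖B.endPoint - B.startPoint‖) :
    ∃ e, ∀ t ∈ Icc 0 L, τ t = e := by
  set d := B.endPoint - B.startPoint with hdef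
  have hd0 : 0 < ‖d‖ := hL.trans_le hd
  refine ⟨‖d‖⁻¹ • d, ?_⟩
  have hle : ∀ t ∈ Icc 0 L, ⟪d, τ t⟫ ≤ ‖d‖ := fun t ht => by
    simpa [h.norm_eq_one t ht] using real_inner_le_norm d (τ t)
  -- This function is nonnegative on `[0, L]` with integral `‖d‖ (L - ‖d‖) ≤ 0`, hence vanishes
  -- there; equality in Cauchy–Schwarz forces `τ = d / ‖d‖`.
  have hcont : Continuous fun t => ‖d‖ - ⟪d, τ t⟫ :=
    continuous_const.sub (continuous_const.inner h.continuous)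
  have hint : ∫ t in (0 : ℝ)..L, (‖d‖ - ⟪d, τ t⟫) = L * ‖d‖ - ‖d‖ ^ 2 := by
    rw [intervalIntegral.integral_sub (by simp)
      ((continuous_const.inner h.continuous).intervalIntegrable _ _)]
    have := (innerSL ℝ d).intervalIntegral_comp_comm
      (h.continuous.intervalIntegrable (μ := volume) 0 L)
    simp only [innerSL_apply_apply] at this
    rw [this, h.integral_eq, ← hdef, real_inner_self_eq_norm_sq]
    simp
  intro t ht
  have heq : ⟪d, τ t⟫ = ‖d‖ := by
    by_contra hne
    have := intervalIntegral.integral_pos hL hcont.continuousOn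
      (fun s hs => sub_nonneg.2 (hle s (Ioc_subset_Icc_self hs)))
      ⟨t, ht, sub_pos.2 (lt_of_le_of_ne (hle t ht) hne)⟩
    rw [hint] at this
    nlinarith
  have h2 : ⟪d, τ t⟫ = ‖d‖ * ‖τ t‖ := by rw [heq, h.norm_eq_one t ht, mul_one]
  have h3 := inner_eq_norm_mul_iff_real.1 h2
  rw [h.norm_eq_one t ht, one_smul] at h3
  calc τ t = ‖d‖⁻¹ • (‖d‖ • τ t) := by rw [smul_smul, inv_mul_cancel₀ hd0.ne', one_smul]
    _ = ‖d‖⁻¹ • d := by rw [← h3]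

end IsTangentField

/-- The tangent field `τ`, tilted in direction `v` away from the end points. -/
noncomputable def tilt (L : ℝ) (τ : ℝ → E m) (v : E m) (s : ℝ) : E m :=
  ‖τ s + (s * (L - s)) • v‖⁻¹ • (τ s + (s * (L - s)) • v)

/-- The derivative of the tilted tangent field. -/
noncomputable def tiltDeriv (L : ℝ) (τ κ : ℝ → E m) (v : E m) (s : ℝ) : E m :=
  normalizeDeriv (τ s + (s * (L - s)) • v) (κ s + (L - 2 * s) • v)

namespace IsTangentField

variable {v : E m}

theorem half_le_norm_tilt (h : IsTangentField L K B τ κ) (hv : L ^ 2 * ‖v‖ ≤ 1 / 2) {s : ℝ}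
    (hs : s ∈ Icc 0 L) : 1 / 2 ≤ ‖τ s + (s * (L - s)) • v‖ :=
  (add_smul_norm_bounds (h.norm_eq_one s hs) (mul_sub_mem hs).1
    ((mul_le_mul_of_nonneg_right (mul_sub_mem hs).2 (norm_nonneg v)).trans hv)).1

theorem hasDerivAt_tilt (h : IsTangentField L K B τ κ) (hv : L ^ 2 * ‖v‖ ≤ 1 / 2) {s : ℝ}
    (hs : s ∈ Icc 0 L) : HasDerivAt (tilt L τ v) (tiltDeriv L τ κ v s) s := by
  have hw : HasDerivAt (fun s : ℝ => s * (L - s)) (L - 2 * s) s := by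
    refine ((hasDerivAt_id s).mul ((hasDerivAt_id s).const_sub L)).congr_deriv ?_
    simp; ring
  exact hasDerivAt_normalize (y := fun s => τ s + (s * (L - s)) • v)
    ((h.hasDerivAt s).add (hw.smul_const v))
    (norm_pos_iff.1 (by linarith [h.half_le_norm_tilt hv hs]))

theorem norm_tilt (h : IsTangentField L K B τ κ) (hv : L ^ 2 * ‖v‖ ≤ 1 / 2) {s : ℝ}
    (hs : s ∈ Icc 0 L) : ‖tilt L τ v s‖ = 1 :=
  norm_inv_smul_self (norm_pos_iff.1 (by linarith [h.half_le_norm_tilt hv hs]))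

/-- The weight `s (L - s)` vanishes at both ends, so the clamped tangents survive the tilt. -/
theorem tilt_zero_eq (h : IsTangentField L K B τ κ) (hL : 0 < L) : tilt L τ v 0 = τ 0 := by
  simp [tilt, h.norm_eq_one 0 ⟨le_rfl, hL.le⟩]

theorem tilt_last_eq (h : IsTangentField L K B τ κ) (hL : 0 < L) : tilt L τ v L = τ L := by
  simp [tilt, h.norm_eq_one L ⟨hL.le, le_rfl⟩]

theorem norm_tilt_sub_le (h : IsTangentField L K B τ κ) (hv : L ^ 2 * ‖v‖ ≤ 1 / 2) {s : ℝ}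
    (hs : s ∈ Icc 0 L) : ‖tilt L τ v s - τ s‖ ≤ 4 * L ^ 2 * ‖v‖ := by
  have h1 := norm_normalize_sub_normalize_le (h.half_le_norm_tilt hv hs)
    (show 1 / 2 ≤ ‖τ s‖ by rw [h.norm_eq_one s hs]; norm_num)
  rw [h.norm_eq_one s hs, inv_one, one_smul, add_sub_cancel_left, norm_smul,
    Real.norm_of_nonneg (mul_sub_mem hs).1] at h1
  refine h1.trans ?_
  have := mul_le_mul_of_nonneg_right (mul_sub_mem hs).2 (norm_nonneg v)
  linarith

theorem norm_tiltDeriv_sub_curvature_le (h : IsTangentField L K B τ κ) (hL : 0 < L)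
    (hv : L ^ 2 * ‖v‖ ≤ 1 / 2) {s : ℝ} (hs : s ∈ Icc 0 L) :
    ‖tiltDeriv L τ κ v s - κ s‖ ≤ (4 * L + 24 * L ^ 2 * K) * ‖v‖ := by
  have h1 := norm_normalizeDeriv_sub_le (z₁ := κ s + (L - 2 * s) • v) (z₂ := κ s)
    (h.half_le_norm_tilt hv hs) (show 1 / 2 ≤ ‖τ s‖ by rw [h.norm_eq_one s hs]; norm_num)
  -- As `κ` is orthogonal to the unit vector `τ`, it equals `normalizeDeriv` at `τ`, and the
  -- Lipschitz estimate for `normalizeDeriv` compares it with `tiltDeriv`.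
  rw [normalizeDeriv_of_norm_eq_one (h.norm_eq_one s hs) (h.inner_eq_zero hL s hs),
    add_sub_cancel_left, add_sub_cancel_left, norm_smul, norm_smul,
    Real.norm_of_nonneg (mul_sub_mem hs).1, Real.norm_eq_abs] at h1
  refine h1.trans ?_
  have h2 : |L - 2 * s| ≤ L := abs_le.2 ⟨by linarith [hs.2], by linarith [hs.1]⟩
  have h3 := mul_le_mul_of_nonneg_right h2 (norm_nonneg v)
  have h4 := mul_le_mul (mul_le_mul_of_nonneg_right (mul_sub_mem hs).2 (norm_nonneg v))
    (h.norm_curvature_le s) (norm_nonneg _) (by positivity)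
  linarith

theorem norm_tiltDeriv_sub_le (h : IsTangentField L K B τ κ)
    (hv : L ^ 2 * ‖v‖ ≤ 1 / 2) (hv1 : ‖v‖ ≤ 1) {s t : ℝ} (hs : s ∈ Icc 0 L) (ht : t ∈ Icc 0 L) :
    ‖tiltDeriv L τ κ v s - tiltDeriv L τ κ v t‖ ≤ (4 * (K + 2) + 24 * (K + L) ^ 2) * |s - t| := by
  have hL0 : 0 ≤ L := hs.1.trans hs.2
  have hK := h.bound_nonneg
  have h1 := norm_normalizeDeriv_sub_le (z₁ := κ s + (L - 2 * s) • v)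
    (z₂ := κ t + (L - 2 * t) • v) (h.half_le_norm_tilt hv hs) (h.half_le_norm_tilt hv ht)
  refine h1.trans ?_
  have hz : ‖κ s + (L - 2 * s) • v - (κ t + (L - 2 * t) • v)‖ ≤ (K + 2) * |s - t| := by
    have e : κ s + (L - 2 * s) • v - (κ t + (L - 2 * t) • v) =
        (κ s - κ t) + (-2 * (s - t)) • v := by module
    rw [e]
    refine (norm_add_le _ _).trans ?_
    rw [norm_smul, norm_mul, Real.norm_eq_abs, Real.norm_eq_abs]
    have := mul_le_mul_of_nonneg_left hv1 (mul_nonneg (abs_nonneg (-2 : ℝ)) (abs_nonneg (s - t)))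
    rw [abs_neg, abs_two] at this ⊢
    linarith [h.lipschitz s t]
  have hy : ‖τ s + (s * (L - s)) • v - (τ t + (t * (L - t)) • v)‖ ≤ (K + L) * |s - t| := by
    have e : τ s + (s * (L - s)) • v - (τ t + (t * (L - t)) • v) =
        (τ s - τ t) + (s * (L - s) - t * (L - t)) • v := by module
    rw [e]
    refine (norm_add_le _ _).trans ?_
    rw [norm_smul, Real.norm_eq_abs]
    have := mul_le_mul (abs_mul_sub_sub_mul_sub_le hs ht) hv1 (norm_nonneg v) (by positivity)
    linarith [h.norm_sub_le s t]
  have hz2 : ‖κ t + (L - 2 * t) • v‖ ≤ K + L := by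
    refine (norm_add_le _ _).trans (add_le_add (h.norm_curvature_le t) ?_)
    rw [norm_smul, Real.norm_eq_abs]
    have h2 : |L - 2 * t| ≤ L := abs_le.2 ⟨by linarith [ht.2], by linarith [ht.1]⟩
    have := mul_le_mul h2 hv1 (norm_nonneg v) hL0
    linarith
  have := mul_le_mul hy hz2 (norm_nonneg _) (by positivity)
  linarith

end IsTangentField

theorem IntervalPartition.norm_sum_edgeLength_smul_sub_integral_le {F : Type*}
    [NormedAddCommGroup F] [NormedSpace ℝ F] [CompleteSpace F] (T : IntervalPartition L)
    {g : ℝ → F} (hg : Continuous g) {c : Fin (T.k + 1) → F} {η : ℝ}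
    (hc : ∀ I, ∀ t ∈ T.edge I, ‖c I - g t‖ ≤ η) :
    ‖∑ I, T.edgeLength I • c I - ∫ t in (0 : ℝ)..L, g t‖ ≤ η * L := by
  have := norm_sum_smul_sub_integral_le T.strictMono.monotone hg hc
  rwa [T.vertex_zero, T.vertex_last, sub_zero] at this

/-- The sampled tangents can be tilted such that the polygon closes up. -/
theorem exists_tilt_closing_up (hL : 0 < L) (hK : 0 ≤ K) (B : BoundaryData m) :
    ∃ R : ℝ, 0 ≤ R ∧ ∃ h₁ : ℝ, 0 < h₁ ∧ ∀ τ κ : ℝ → E m, IsTangentField L K B τ κ →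
      ∀ T : IntervalPartition L, T.h ≤ h₁ → ∃ v : E m, ‖v‖ ≤ R * T.h ∧
        ∑ I, T.edgeLength I • tilt L τ v (T.samplePoint I) = B.endPoint - B.startPoint := by
  rcases le_or_gt L ‖B.endPoint - B.startPoint‖ with hd | hd
  · refine ⟨0, le_rfl, L / 2, by positivity, fun τ κ h T hT => ⟨0, by simp, ?_⟩⟩
    obtain ⟨e, he⟩ := h.eq_of_le_norm hL hd
    have h1 : ∀ I, tilt L τ 0 (T.samplePoint I) = e := fun I => by
      have hs := IntervalPartition.samplePoint_mem hT I
      rw [tilt, smul_zero, add_zero, h.norm_eq_one _ hs, inv_one, one_smul, he _ hs]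
    simp only [h1]
    rw [← Finset.sum_smul, T.sum_edgeLength, ← h.integral_eq,
      intervalIntegral.integral_congr (g := fun _ => e)
        (fun t ht => he t (by rwa [uIcc_of_le hL.le] at ht))]
    simp
  · obtain ⟨c, hc0, hc⟩ := exists_coercivity (V := E m) hL hK (norm_nonneg _) hd
    -- With closing defect `ε = K h L` and half of the coercivity constant, `c / 2 * (R h) = 4 ε +
    -- h`; the extra `1` makes the required inequality strict.
    set R := (4 * (L * K) + 1) * 2 / c with hR
    have hR0 : 0 < R := by positivity
    set A := (L + 2 * K * L ^ 2) * L with hA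
    have hA0 : 0 < A := by positivity
    -- The three bounds on `h` control the sample points, lose at most half of the coercivity in the
    -- Riemann sum, and keep `L² ‖v‖ ≤ 1 / 2` for `‖v‖ ≤ R h`.
    refine ⟨R, hR0.le, min (L / 2) (min (c / (2 * A)) (1 / (2 * L ^ 2 * R))), by positivity,
      fun τ κ h T hT => ?_⟩
    have hT1 : T.h ≤ L / 2 := hT.trans (min_le_left _ _)
    have hT2 : T.h * (2 * A) ≤ c :=
      (le_div_iff₀ (by positivity)).1 (hT.trans ((min_le_right _ _).trans (min_le_left _ _)))
    have hT3 : T.h * (2 * L ^ 2 * R) ≤ 1 :=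
      (le_div_iff₀ (by positivity)).1 (hT.trans ((min_le_right _ _).trans (min_le_right _ _)))
    have hh := T.h_pos
    have hs := IntervalPartition.samplePoint_mem hT1
    refine exists_tilt_sum_eq (c := c / 2) (ε := K * T.h * L)
      (w := fun I => T.samplePoint I * (L - T.samplePoint I)) (u := fun I => τ (T.samplePoint I))
      (fun I => (T.edgeLength_pos I).le)
      (fun I => (mul_sub_mem (hs I)).1) (fun I => h.norm_eq_one _ (hs I)) (by positivity)
      (fun I => ?_) ?_ (fun v => ?_) ?_
    · have := mul_le_mul_of_nonneg_right (mul_sub_mem (hs I)).2 (mul_pos hR0 hh).le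
      linarith
    · rw [← h.integral_eq]
      refine T.norm_sum_edgeLength_smul_sub_integral_le h.continuous fun I t ht => ?_
      exact (h.norm_sub_le _ _).trans (mul_le_mul_of_nonneg_left
        (IntervalPartition.abs_samplePoint_sub_le hT1 I ht) hK)
    · have h1 := hc τ h.continuous h.norm_eq_one (fun s _ t _ => h.norm_sub_le s t)
        (by rw [h.integral_eq]) v
      have hcont : Continuous fun s => s * (L - s) * (‖v‖ ^ 2 - ⟪τ s, v⟫ ^ 2) := by
        have := h.continuous
        fun_prop
      -- The variation of the weight contributes `L h`, that of `⟪τ, v⟫ ^ 2` contributes `2 K L² h`,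
      -- both relative to `‖v‖ ^ 2`.
      have h2 := T.norm_sum_edgeLength_smul_sub_integral_le hcont
        (c := fun I => T.samplePoint I * (L - T.samplePoint I) *
          (‖v‖ ^ 2 - ⟪τ (T.samplePoint I), v⟫ ^ 2))
        (η := (L + 2 * K * L ^ 2) * T.h * ‖v‖ ^ 2) (fun I t ht => by
          have ht0 := T.edge_subset I ht
          have hst := IntervalPartition.abs_samplePoint_sub_le hT1 I ht
          set s := T.samplePoint I with hsdef
          have hs0 : s ∈ Icc 0 L := hs I
          have e : s * (L - s) * (‖v‖ ^ 2 - ⟪τ s, v⟫ ^ 2) - t * (L - t) * (‖v‖ ^ 2 - ⟪τ t, v⟫ ^ 2)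
              = (s * (L - s) - t * (L - t)) * (‖v‖ ^ 2 - ⟪τ s, v⟫ ^ 2) -
                t * (L - t) * (⟪τ s, v⟫ ^ 2 - ⟪τ t, v⟫ ^ 2) := by ring
          have hf : |‖v‖ ^ 2 - ⟪τ s, v⟫ ^ 2| ≤ ‖v‖ ^ 2 := by
            have := abs_real_inner_le_norm (τ s) v
            rw [h.norm_eq_one s hs0, one_mul] at this
            have h5 := sq_le_sq' (neg_le_of_abs_le this) (le_of_abs_le this)
            rw [abs_of_nonneg (sub_nonneg.2 h5)]
            linarith [sq_nonneg ⟪τ s, v⟫]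
          have h3 := abs_sq_inner_sub_sq_inner_le (v := v) (h.norm_eq_one s hs0)
            (h.norm_eq_one t ht0)
          have h4 : ‖τ s - τ t‖ ≤ K * T.h :=
            (h.norm_sub_le s t).trans (mul_le_mul_of_nonneg_left hst hK)
          have h5 : |⟪τ s, v⟫ ^ 2 - ⟪τ t, v⟫ ^ 2| ≤ 2 * (K * T.h) * ‖v‖ ^ 2 :=
            h3.trans (mul_le_mul_of_nonneg_right (by linarith) (sq_nonneg _))
          have h6 : |s * (L - s) - t * (L - t)| ≤ L * T.h :=
            (abs_mul_sub_sub_mul_sub_le hs0 ht0).trans (mul_le_mul_of_nonneg_left hst hL.le)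
          rw [e, Real.norm_eq_abs]
          refine (abs_sub _ _).trans ?_
          rw [abs_mul, abs_mul, abs_of_nonneg (mul_sub_mem ht0).1]
          have h7 := mul_le_mul h6 hf (abs_nonneg _) (by positivity)
          have h8 := mul_le_mul (mul_sub_mem ht0).2 h5 (abs_nonneg _) (by positivity)
          linarith)
      rw [Real.norm_eq_abs] at h2
      simp only [smul_eq_mul] at h2
      have h3 := (abs_le.1 h2).1
      have h4 : T.h * (2 * A) * ‖v‖ ^ 2 ≤ c * ‖v‖ ^ 2 :=
        mul_le_mul_of_nonneg_right hT2 (sq_nonneg _)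
      simp only [mul_assoc] at h1 h3 h4 ⊢
      rw [hA] at h4
      linarith
    · have : c / 2 * (R * T.h) = (4 * (L * K) + 1) * T.h := by rw [hR]; field_simp
      rw [this]
      linarith

end Elastica

/-! ### Polygons with prescribed edge directions and their interpolation -/

namespace Elastica

open scoped RealInnerProductSpace

variable {m : ℕ} {L : ℝ}

namespace IntervalPartition

variable (T : IntervalPartition L)

/-- The polygon with initial point `q`, the edge lengths of `T` and the edge directions `θ`. -/
def polygonOfTangents (q : E m) (θ : Fin (T.k + 1) → E m) : T.Polygon m :=
  fun n => q + Fin.partialSum (fun I => T.edgeLength I • θ I) n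

section PolygonOfTangents

variable {T} {q : E m} {θ : Fin (T.k + 1) → E m}

theorem polygonOfTangents_zero : T.polygonOfTangents q θ 0 = q := by
  simp [polygonOfTangents]

theorem polygonOfTangents_succ_sub (I : Fin (T.k + 1)) :
    T.polygonOfTangents q θ I.succ - T.polygonOfTangents q θ I.castSucc =
      T.edgeLength I • θ I := by
  simp only [polygonOfTangents, Fin.partialSum_succ]; abel

theorem polygonOfTangents_last : T.polygonOfTangents q θ (Fin.last (T.k + 1)) =
    q + ∑ I, T.edgeLength I • θ I := by
  have h := sum_succ_sub_castSucc (T.polygonOfTangents q θ)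
  simp only [polygonOfTangents_succ_sub] at h
  rw [h, polygonOfTangents_zero]; abel

theorem edgeLength_polygonOfTangents (hθ : ∀ I, ‖θ I‖ = 1) (I : Fin (T.k + 1)) :
    (T.polygonOfTangents q θ).edgeLength I = T.edgeLength I := by
  rw [Polygon.edgeLength, polygonOfTangents_succ_sub, norm_smul, hθ, mul_one,
    Real.norm_of_nonneg (T.edgeLength_pos I).le]

theorem tangent_polygonOfTangents (hθ : ∀ I, ‖θ I‖ = 1) (I : Fin (T.k + 1)) :
    (T.polygonOfTangents q θ).tangent I = θ I := by
  rw [Polygon.tangent, edgeLength_polygonOfTangents hθ, polygonOfTangents_succ_sub, smul_smul,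
    inv_mul_cancel₀ (T.edgeLength_pos I).ne', one_smul]

theorem strain_polygonOfTangents (hθ : ∀ I, ‖θ I‖ = 1) (I : Fin (T.k + 1)) :
    (T.polygonOfTangents q θ).strain I = 0 := by
  rw [Polygon.strain, edgeLength_polygonOfTangents hθ, div_self (T.edgeLength_pos I).ne',
    Real.log_one]

theorem dualLength_polygonOfTangents (hθ : ∀ I, ‖θ I‖ = 1) (i : Fin T.k) :
    (T.polygonOfTangents q θ).dualLength i = T.midpoint i.succ - T.midpoint i.castSucc := by
  rw [Polygon.dualLength, edgeLength_polygonOfTangents hθ, edgeLength_polygonOfTangents hθ,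
    midpoint_succ_sub]

theorem polygonOfTangents_mem_feasible {B : BoundaryData m} (hθ : ∀ I, ‖θ I‖ = 1)
    (h0 : θ 0 = B.startTangent) (hl : θ (Fin.last T.k) = B.endTangent)
    (hs : ∑ I, T.edgeLength I • θ I = B.endPoint - B.startPoint) :
    T.polygonOfTangents B.startPoint θ ∈ T.feasible B := by
  refine ⟨fun I heq => ?_, polygonOfTangents_zero, ?_, ?_, ?_, strain_polygonOfTangents hθ⟩
  · have h1 := edgeLength_polygonOfTangents (q := B.startPoint) hθ I
    rw [Polygon.edgeLength, heq, sub_self, norm_zero] at h1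
    exact (T.edgeLength_pos I).ne h1
  · rw [polygonOfTangents_last, hs, add_sub_cancel]
  · rw [tangent_polygonOfTangents hθ, h0]
  · rw [tangent_polygonOfTangents hθ, hl]

end PolygonOfTangents

theorem exists_mem_Ico {t : ℝ} (ht : t ∈ Ico 0 L) :
    ∃ I : Fin (T.k + 1), T.vertex I.castSucc ≤ t ∧ t < T.vertex I.succ := by
  by_contra! hcon
  have : ∀ n, T.vertex n ≤ t := fun n => by
    induction n using Fin.induction with
    | zero => rw [T.vertex_zero]; exact ht.1
    | succ I ih => exact hcon I ih
  exact absurd (this (Fin.last _)) (by rw [T.vertex_last]; exact not_le.2 ht.2)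

variable {T}

theorem Polygon.continuous_interp (P : T.Polygon m) : Continuous P.interp := by
  unfold Polygon.interp
  fun_prop

theorem Polygon.interp_zero (P : T.Polygon m) : P.interp 0 = P 0 := by
  have h : (0 : ℝ) ∈ T.edge 0 := by
    have h1 := T.vertex_zero
    exact ⟨h1.le, (T.vertex_mem _).1⟩
  have h1 : T.vertex (Fin.castSucc 0) = 0 := T.vertex_zero
  rw [P.interp_of_mem_edge 0 h, h1]
  simp

theorem Polygon.hasDerivAt_interp (P : T.Polygon m) {I : Fin (T.k + 1)} {t : ℝ}
    (ht : t ∈ Ioo (T.vertex I.castSucc) (T.vertex I.succ)) :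
    HasDerivAt P.interp ((T.edgeLength I)⁻¹ • (P I.succ - P I.castSucc)) t := by
  have h1 : HasDerivAt (fun t => P I.castSucc +
      ((t - T.vertex I.castSucc) / T.edgeLength I) • (P I.succ - P I.castSucc))
      ((T.edgeLength I)⁻¹ • (P I.succ - P I.castSucc)) t := by
    have := (((hasDerivAt_id t).sub_const (T.vertex I.castSucc)).div_const
      (T.edgeLength I)).smul_const (P I.succ - P I.castSucc)
    simpa using this.const_add (P I.castSucc)
  refine h1.congr_of_eventuallyEq ?_
  filter_upwards [Ioo_mem_nhds ht.1 ht.2] with s hs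
    using P.interp_of_mem_edge I (Ioo_subset_Icc_self hs)

/-- A polygon whose edge directions are close to `τ` is close to the curve with tangent `τ`. -/
theorem Polygon.sobolevNorm_interp_sub_le (hL : 0 < L) (P : T.Polygon m) {τ u : ℝ → E m} {c : ℝ}
    (hτ : Continuous τ) (hu : ∀ t ∈ Icc 0 L, u t = P 0 + ∫ s in (0 : ℝ)..t, τ s)
    (hc : ∀ I, ∀ t ∈ T.edge I, ‖(T.edgeLength I)⁻¹ • (P I.succ - P I.castSucc) - τ t‖ ≤ c) :
    sobolevNorm L 1 ⊤ (fun t => P.interp t - u t) ≤ ENNReal.ofReal (c * (L + 1)) := by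
  have hc0 : 0 ≤ c := (norm_nonneg _).trans
    (hc 0 _ ⟨le_rfl, (T.strictMono (Fin.castSucc_lt_succ (i := 0))).le⟩)
  -- Off the vertices `e` is the derivative of the difference; the value of `deriv` at the countably
  -- many vertices does not matter.
  set e : ℝ → E m := fun t => deriv P.interp t - τ t with he
  have hcount : (range T.vertex).Countable := countable_range _
  have hder : ∀ t ∈ Ioo 0 L \ range T.vertex,
      HasDerivAt P.interp (deriv P.interp t) t ∧ ‖e t‖ ≤ c := by
    rintro t ⟨ht, htv⟩
    obtain ⟨I, hI1, hI2⟩ := T.exists_mem_Ico (Ioo_subset_Ico_self ht)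
    have hI : t ∈ Ioo (T.vertex I.castSucc) (T.vertex I.succ) :=
      ⟨lt_of_le_of_ne hI1 fun h => htv ⟨_, h⟩, hI2⟩
    have hd := P.hasDerivAt_interp hI
    refine ⟨hd.differentiableAt.hasDerivAt, ?_⟩
    rw [he]; simp only
    rw [hd.deriv]
    exact hc I t (Ioo_subset_Icc_self hI)
  have hbd : ∀ᵐ t ∂intervalMeasure L, ‖e t‖ ≤ c := by
    rw [intervalMeasure, ae_restrict_iff' measurableSet_Ioo]
    filter_upwards [hcount.ae_notMem volume] with t ht htL using (hder t ⟨htL, ht⟩).2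
  have hei : IntegrableOn e (Ioo 0 L) :=
    ⟨((stronglyMeasurable_deriv _).sub hτ.stronglyMeasurable).aestronglyMeasurable,
      .of_bounded hbd⟩
  have heii : ∀ t ∈ Icc 0 L, IntervalIntegrable e volume 0 t := fun t ht => by
    have h1 : IntegrableOn e (Icc 0 L) :=
      (integrableOn_Icc_iff_integrableOn_Ioo (by simp) (by simp)).2 hei
    exact (h1.mono_set (uIcc_subset_Icc ⟨le_rfl, hL.le⟩ ht)).intervalIntegrable
  have hprim : ∀ t ∈ Icc 0 L, P.interp t - u t = 0 + ∫ s in (0 : ℝ)..t, e s := by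
    intro t ht
    have hτd : ∀ s, HasDerivAt (fun s => P 0 + ∫ r in (0 : ℝ)..s, τ r) (τ s) s := fun s =>
      (intervalIntegral.integral_hasDerivAt_right (hτ.intervalIntegrable _ _)
        (hτ.stronglyMeasurableAtFilter _ _) hτ.continuousAt).const_add (P 0)
    have hcτ : Continuous (fun s => P 0 + ∫ r in (0 : ℝ)..s, τ r) :=
      continuous_iff_continuousAt.2 fun s => (hτd s).continuousAt
    rw [integral_eq_of_hasDerivAt_off_countable
      (fun s => P.interp s - (P 0 + ∫ r in (0 : ℝ)..s, τ r)) e hcount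
      (P.continuous_interp.sub hcτ).continuousOn (fun s hs => ?_) (heii t ht), hu t ht]
    · simp [P.interp_zero]
    · rw [min_eq_left ht.1, max_eq_right ht.1] at hs
      exact (hder s ⟨⟨hs.1.1, hs.1.2.trans_le ht.2⟩, hs.2⟩).1.sub (hτd s)
  have hw : HasWeakDeriv L 1 (fun t => P.interp t - u t) e :=
    hasWeakDeriv_of_ae_eq_primitive hL hei 0
      (ae_intervalMeasure_of_forall fun t ht => hprim t (Ioo_subset_Icc_self ht))
  -- Both curves start at `P 0`, so the difference is the integral of `e` from `0`; the derivative
  -- then adds `c` to the bound `c L`.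
  have h0 : sobolevSeminorm L 0 ⊤ (fun t => P.interp t - u t) ≤ ENNReal.ofReal (c * L) := by
    refine (hasWeakDeriv_zero hw.1).sobolevSeminorm_le (ae_intervalMeasure_of_forall fun t ht => ?_)
    rw [hprim t (Ioo_subset_Icc_self ht), zero_add]
    have h1 : ‖∫ s in (0 : ℝ)..t, e s‖ ≤ c * |t - 0| := by
      refine intervalIntegral.norm_integral_le_of_norm_le_const_ae ?_
      rw [intervalMeasure, Measure.restrict_congr_set Ioo_ae_eq_Ioc,
        ae_restrict_iff' measurableSet_Ioc] at hbd
      filter_upwards [hbd] with s hs hst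
      rw [uIoc_of_le ht.1.le] at hst
      exact hs ⟨hst.1, hst.2.trans ht.2.le⟩
    rw [sub_zero, abs_of_pos ht.1] at h1
    exact h1.trans (mul_le_mul_of_nonneg_left ht.2.le hc0)
  have h1 := hw.sobolevSeminorm_le hbd
  rw [sobolevNorm, Finset.sum_range_succ, Finset.sum_range_one, mul_add, mul_one,
    ENNReal.ofReal_add (by positivity) hc0]
  exact add_le_add h0 h1

end IntervalPartition

/-! ### Consistency estimates for the sampled polygon -/

/-- The squared angle between nearby unit vectors agrees with the squared distance up to fourth
order. -/
theorem abs_sq_angle_sub_sq_norm_sub_le {V : Type*} [NormedAddCommGroup V] [InnerProductSpace ℝ V]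
    {x y : V} (hx : ‖x‖ = 1) (hy : ‖y‖ = 1) (hxy : ‖x - y‖ ≤ 1 / 2) :
    |InnerProductGeometry.angle x y ^ 2 - ‖x - y‖ ^ 2| ≤ 2 * ‖x - y‖ ^ 4 := by
  set α := InnerProductGeometry.angle x y
  have hα0 : 0 ≤ α := InnerProductGeometry.angle_nonneg x y
  have hαπ : α ≤ Real.pi := InnerProductGeometry.angle_le_pi x y
  have hcos : Real.cos α = 1 - ‖x - y‖ ^ 2 / 2 := by
    rw [InnerProductGeometry.cos_angle, hx, hy, norm_sub_sq_real, hx, hy]; ring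
  have hπ := Real.pi_pos
  -- A bootstrap: the quadratic upper bound for the cosine first gives `α ≤ 2 ‖x - y‖ ≤ 1`, after
  -- which its Taylor bound applies.
  have h1 := Real.cos_le_one_sub_mul_cos_sq (x := α) (by rwa [abs_of_nonneg hα0])
  rw [hcos] at h1
  have h2 : α ^ 2 ≤ 4 * ‖x - y‖ ^ 2 := by
    have h3 : 2 / Real.pi ^ 2 * α ^ 2 ≤ ‖x - y‖ ^ 2 / 2 := by linarith
    rw [div_mul_eq_mul_div, div_le_iff₀ (by positivity)] at h3
    have h4 : Real.pi ^ 2 ≤ 16 := by nlinarith [Real.pi_le_four]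
    nlinarith [sq_nonneg ‖x - y‖]
  have h3 : |α| ≤ 1 := by
    rw [abs_of_nonneg hα0]
    nlinarith [norm_nonneg (x - y)]
  have h4 := Real.cos_bound h3
  rw [hcos, abs_of_nonneg hα0] at h4
  have h5 : α ^ 4 ≤ 16 * ‖x - y‖ ^ 4 := by
    nlinarith [sq_nonneg α, sq_nonneg ‖x - y‖]
  have e : α ^ 2 - ‖x - y‖ ^ 2 = 2 * (1 - ‖x - y‖ ^ 2 / 2 - (1 - α ^ 2 / 2)) := by ring
  rw [e, abs_mul, abs_two]
  have h6 : 0 ≤ ‖x - y‖ ^ 4 := by positivity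
  linarith

/-- `θ` is a unit vector field with Lipschitz derivative `θ'`, and `(θ, θ')` is `M * h`-close to
`(τ, κ)`. -/
structure IsApproxTangentField (L M h : ℝ) (τ κ θ θ' : ℝ → E m) : Prop where
  hasDerivAt : ∀ s ∈ Icc 0 L, HasDerivAt θ (θ' s) s
  norm_eq_one : ∀ s ∈ Icc 0 L, ‖θ s‖ = 1
  norm_sub_le : ∀ s ∈ Icc 0 L, ‖θ s - τ s‖ ≤ M * h
  norm_deriv_sub_le : ∀ s ∈ Icc 0 L, ‖θ' s - κ s‖ ≤ M * h
  lipschitz : ∀ s ∈ Icc 0 L, ∀ t ∈ Icc 0 L, ‖θ' s - θ' t‖ ≤ M * |s - t|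
  norm_deriv_le : ∀ s ∈ Icc 0 L, ‖θ' s‖ ≤ M

namespace IsApproxTangentField

open IntervalPartition

variable {M h : ℝ} {τ κ θ θ' : ℝ → E m}

/-- Mean value inequality for `x ↦ θ x - x • θ' ξ`. Leaving `ξ` free in `[s, t]` allows neighbouring
intervals to be compared at their common end. -/
theorem norm_sub_sub_smul_le (H : IsApproxTangentField L M h τ κ θ θ') {s t ξ : ℝ}
    (hs : 0 ≤ s) (ht : t ≤ L) (hξ : ξ ∈ Icc s t) :
    ‖θ t - θ s - (t - s) • θ' ξ‖ ≤ M * (t - s) * (t - s) := by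
  have hst : s ≤ t := hξ.1.trans hξ.2
  have hsub : Icc s t ⊆ Icc 0 L := Icc_subset_Icc hs ht
  have hM : 0 ≤ M := (norm_nonneg _).trans (H.norm_deriv_le ξ (hsub hξ))
  have := (convex_Icc s t).norm_image_sub_le_of_norm_hasDerivWithin_le
    (f := fun x => θ x - x • θ' ξ) (f' := fun x => θ' x - θ' ξ) (C := M * (t - s))
    (fun x hx => by
      have := (H.hasDerivAt x (hsub hx)).sub ((hasDerivAt_id x).smul_const (θ' ξ))
      rw [one_smul] at this
      exact this.hasDerivWithinAt)
    (fun x hx => (H.lipschitz x (hsub hx) ξ (hsub hξ)).trans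
      (mul_le_mul_of_nonneg_left
        (abs_le.2 ⟨by linarith [hx.1, hξ.2], by linarith [hx.2, hξ.1]⟩) hM))
    (left_mem_Icc.2 hst) (right_mem_Icc.2 hst)
  rw [Real.norm_of_nonneg (sub_nonneg.2 hst)] at this
  refine le_trans (le_of_eq ?_) this
  congr 1
  module

variable {T : IntervalPartition L} {q : E m}

theorem norm_samplePoint (H : IsApproxTangentField L M h τ κ θ θ') (hh : T.h ≤ L / 2)
    (I : Fin (T.k + 1)) : ‖θ (T.samplePoint I)‖ = 1 :=
  H.norm_eq_one _ (samplePoint_mem hh I)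

theorem dualLength_pos (H : IsApproxTangentField L M h τ κ θ θ') (hh : T.h ≤ L / 2)
    (i : Fin T.k) :
    0 < (T.polygonOfTangents q fun I => θ (T.samplePoint I)).dualLength i := by
  rw [dualLength_polygonOfTangents (H.norm_samplePoint hh)]
  exact sub_pos.2 (T.midpoint_strictMono (Fin.castSucc_lt_succ (i := i)))

theorem dualLength_le (H : IsApproxTangentField L M h τ κ θ θ') (hh : T.h ≤ L / 2)
    (i : Fin T.k) :
    (T.polygonOfTangents q fun I => θ (T.samplePoint I)).dualLength i ≤ T.h := by
  rw [dualLength_polygonOfTangents (H.norm_samplePoint hh), midpoint_succ_sub]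
  linarith [T.edgeLength_le_h i.castSucc, T.edgeLength_le_h i.succ]

/-- The dual length times `L / T.midpointSpan` is the sample gap. Retaining this factor makes the
error proportional to the gap and so summable; replacing the factor by `1` would cost `O(h)` at each
vertex, which need not sum up when many edges are short. -/
theorem norm_curvature_sub_smul_deriv_le (H : IsApproxTangentField L M h τ κ θ θ')
    (hh : T.h ≤ L / 2) (i : Fin T.k) {ξ : ℝ}
    (hξ : ξ ∈ Icc (T.samplePoint i.castSucc) (T.samplePoint i.succ)) :
    ‖(T.polygonOfTangents q fun I => θ (T.samplePoint I)).curvature i -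
        (L / T.midpointSpan) • θ' ξ‖ ≤
      2 * M * (T.samplePoint i.succ - T.samplePoint i.castSucc) := by
  have hpos := H.dualLength_pos (q := q) hh i
  have hM : 0 ≤ M := (norm_nonneg _).trans (H.norm_deriv_le 0
    ⟨le_rfl, (length_pos_of_h_le hh).le⟩)
  have hgap := (sub_pos.2 (samplePoint_strictMono hh (Fin.castSucc_lt_succ (i := i)))).le
  have h1 := H.norm_sub_sub_smul_le (samplePoint_mem hh i.castSucc).1 (samplePoint_mem hh i.succ).2
    hξ
  have hs := T.samplePoint_succ_sub i
  have hd := dualLength_polygonOfTangents (q := q) (H.norm_samplePoint hh) i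
  rw [Polygon.curvature, tangent_polygonOfTangents (H.norm_samplePoint hh),
    tangent_polygonOfTangents (H.norm_samplePoint hh)]
  rw [← hd] at hs
  set l := (T.polygonOfTangents q fun I => θ (T.samplePoint I)).dualLength i
  have e : l⁻¹ • (θ (T.samplePoint i.succ) - θ (T.samplePoint i.castSucc)) -
      (L / T.midpointSpan) • θ' ξ = l⁻¹ • (θ (T.samplePoint i.succ) - θ (T.samplePoint i.castSucc) -
        (T.samplePoint i.succ - T.samplePoint i.castSucc) • θ' ξ) := by
    rw [smul_sub _ _ (_ • θ' ξ), smul_smul, hs, mul_comm (L / T.midpointSpan) l, ← mul_assoc,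
      inv_mul_cancel₀ hpos.ne', one_mul]
  rw [e, norm_smul, norm_inv, Real.norm_of_nonneg hpos.le, inv_mul_le_iff₀ hpos]
  refine h1.trans ?_
  have h2 := mul_le_mul_of_nonneg_right (length_div_midpointSpan_le hh) hpos.le
  rw [← hs] at h2
  have h3 := mul_le_mul_of_nonneg_left h2 (mul_nonneg hM hgap)
  linarith

theorem norm_curvature_le (H : IsApproxTangentField L M h τ κ θ θ')
    (hh : T.h ≤ L / 2) (i : Fin T.k) :
    ‖(T.polygonOfTangents q fun I => θ (T.samplePoint I)).curvature i‖ ≤ 2 * M := by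
  have hpos := H.dualLength_pos (q := q) hh i
  have hM : 0 ≤ M := (norm_nonneg _).trans (H.norm_deriv_le 0
    ⟨le_rfl, (length_pos_of_h_le hh).le⟩)
  have hgap := (sub_pos.2 (samplePoint_strictMono hh (Fin.castSucc_lt_succ (i := i)))).le
  have h1 := (convex_Icc 0 L).norm_image_sub_le_of_norm_hasDerivWithin_le
    (fun x hx => (H.hasDerivAt x hx).hasDerivWithinAt) H.norm_deriv_le
    (samplePoint_mem hh i.castSucc) (samplePoint_mem hh i.succ)
  rw [Real.norm_of_nonneg hgap] at h1
  have hs := T.samplePoint_succ_sub i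
  have hd := dualLength_polygonOfTangents (q := q) (H.norm_samplePoint hh) i
  rw [Polygon.curvature, tangent_polygonOfTangents (H.norm_samplePoint hh),
    tangent_polygonOfTangents (H.norm_samplePoint hh)]
  rw [← hd] at hs
  set l := (T.polygonOfTangents q fun I => θ (T.samplePoint I)).dualLength i
  rw [norm_smul, norm_inv, Real.norm_of_nonneg hpos.le, inv_mul_le_iff₀ hpos]
  refine h1.trans ?_
  have h2 := mul_le_mul_of_nonneg_right (length_div_midpointSpan_le hh) hpos.le
  rw [← hs] at h2
  have h3 := mul_le_mul_of_nonneg_left h2 hM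
  linarith

theorem norm_curvature_sub_curvature_le (H : IsApproxTangentField L M T.h τ κ θ θ')
    (hκ : ∀ s t, ‖κ s - κ t‖ ≤ M * |s - t|) (hh : T.h ≤ L / 2) (i : Fin T.k) {r : ℝ}
    (hr : |T.samplePoint i.castSucc - r| ≤ 2 * T.h) :
    ‖(T.polygonOfTangents q fun I => θ (T.samplePoint I)).curvature i - κ r‖ ≤
      (7 + 2 / L) * M * T.h := by
  have hM : 0 ≤ M := (norm_nonneg _).trans (H.norm_deriv_le 0
    ⟨le_rfl, (length_pos_of_h_le hh).le⟩)
  have hpos := H.dualLength_pos (q := q) hh i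
  have hgap := (sub_pos.2 (samplePoint_strictMono hh (Fin.castSucc_lt_succ (i := i)))).le
  have hmem := samplePoint_mem hh i.castSucc
  have h1 := H.norm_curvature_sub_smul_deriv_le (q := q) hh i
    (left_mem_Icc.2 (sub_nonneg.1 hgap))
  have h2 : T.samplePoint i.succ - T.samplePoint i.castSucc ≤ 2 * T.h := by
    rw [T.samplePoint_succ_sub i,
      ← dualLength_polygonOfTangents (q := q) (H.norm_samplePoint hh) i]
    exact mul_le_mul (length_div_midpointSpan_le hh) (H.dualLength_le hh i) hpos.le two_pos.le
  have h3 := mul_le_mul_of_nonneg_left h2 (mul_nonneg two_pos.le hM)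
  have h4 : ‖(L / T.midpointSpan - 1) • θ' (T.samplePoint i.castSucc)‖ ≤ 2 / L * T.h * M := by
    rw [norm_smul, Real.norm_of_nonneg (sub_nonneg.2 (one_le_length_div_midpointSpan hh))]
    exact mul_le_mul (length_div_midpointSpan_sub_one_le hh) (H.norm_deriv_le _ hmem)
      (norm_nonneg _) (mul_nonneg (div_nonneg two_pos.le (length_pos_of_h_le hh).le) T.h_pos.le)
  have h5 := H.norm_deriv_sub_le _ hmem
  have h6 := (hκ (T.samplePoint i.castSucc) r).trans (mul_le_mul_of_nonneg_left hr hM)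
  set P := T.polygonOfTangents q fun I => θ (T.samplePoint I)
  -- The four errors are at most `4 M h` (Taylor), `2 / L * M h` (rescaling), `M h` (tilt) and `2 M
  -- h` (Lipschitz continuity of `κ`).
  have e : P.curvature i - κ r =
      (P.curvature i - (L / T.midpointSpan) • θ' (T.samplePoint i.castSucc)) +
      (L / T.midpointSpan - 1) • θ' (T.samplePoint i.castSucc) +
      (θ' (T.samplePoint i.castSucc) - κ (T.samplePoint i.castSucc)) +
      (κ (T.samplePoint i.castSucc) - κ r) := by
    module
  rw [e]
  refine norm_add₄_le.trans ?_
  linarith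

theorem seminormTV3_le (H : IsApproxTangentField L M h τ κ θ θ') (hh : T.h ≤ L / 2) :
    (T.polygonOfTangents q fun I => θ (T.samplePoint I)).seminormTV3 ≤ 4 * M * L := by
  have hM : 0 ≤ M := (norm_nonneg _).trans (H.norm_deriv_le 0
    ⟨le_rfl, (length_pos_of_h_le hh).le⟩)
  set P := T.polygonOfTangents q fun I => θ (T.samplePoint I) with hP
  set g : Fin T.k → ℝ := fun i => T.samplePoint i.succ - T.samplePoint i.castSucc with hg
  have hg0 : ∀ i, 0 ≤ g i := fun i =>
    (sub_pos.2 (samplePoint_strictMono hh (Fin.castSucc_lt_succ (i := i)))).le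
  have hgs : ∑ i, g i = L := by
    rw [hg, sum_succ_sub_castSucc T.samplePoint, samplePoint_last hh, samplePoint_zero, sub_zero]
  have hterm : ∀ j : Fin (T.k - 1), ‖P.curvatureDeriv j‖ * P.edgeLength ⟨j + 1, by omega⟩ ≤
      2 * M * (g ⟨j + 1, by omega⟩ + g ⟨j, by omega⟩) := by
    intro j
    have hpos : 0 < P.edgeLength ⟨j + 1, by omega⟩ := by
      rw [hP, edgeLength_polygonOfTangents (H.norm_samplePoint hh)]
      exact T.edgeLength_pos _
    rw [Polygon.curvatureDeriv, norm_smul, norm_inv, Real.norm_of_nonneg hpos.le, mul_right_comm,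
      inv_mul_cancel₀ hpos.ne', one_mul]
    have h1 := H.norm_curvature_sub_smul_deriv_le (q := q) hh ⟨j + 1, by omega⟩
      (left_mem_Icc.2 (sub_nonneg.1 (hg0 ⟨j + 1, by omega⟩)))
    have h2 := H.norm_curvature_sub_smul_deriv_le (q := q) hh ⟨j, by omega⟩
      (right_mem_Icc.2 (sub_nonneg.1 (hg0 ⟨j, by omega⟩)))
    rw [norm_sub_rev] at h2
    -- Both curvatures are compared with the same derivative, at the sample point shared by the two
    -- adjacent gaps. Each gap is used at most twice, hence `2 M * 2 L` in total.
    have e : P.curvature ⟨j + 1, by omega⟩ - P.curvature ⟨j, by omega⟩ =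
        (P.curvature ⟨j + 1, by omega⟩ - (L / T.midpointSpan) •
          θ' (T.samplePoint (Fin.castSucc ⟨j + 1, by omega⟩))) +
        ((L / T.midpointSpan) • θ' (T.samplePoint (Fin.succ ⟨j, by omega⟩)) -
          P.curvature ⟨j, by omega⟩) := by
      have : (Fin.castSucc ⟨j + 1, by omega⟩ : Fin (T.k + 1)) = Fin.succ ⟨j, by omega⟩ := rfl
      rw [this]; abel
    rw [e, mul_add]
    exact (norm_add_le _ _).trans (add_le_add h1 h2)
  refine (Finset.sum_le_sum fun j _ => hterm j).trans ?_
  rw [← Finset.mul_sum, Finset.sum_add_distrib]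
  have hs1 : ∑ j : Fin (T.k - 1), g ⟨j + 1, by omega⟩ ≤ L := by
    refine le_of_le_of_eq ?_ hgs
    refine (Finset.sum_image (s := Finset.univ) (f := g)
      (g := fun j : Fin (T.k - 1) => (⟨j + 1, by omega⟩ : Fin T.k)) ?_).symm.trans_le
      (Finset.sum_le_sum_of_subset_of_nonneg (Finset.subset_univ _) fun i _ _ => hg0 i)
    intro a _ b _ hab
    exact Fin.ext (by simpa using hab)
  have hs2 : ∑ j : Fin (T.k - 1), g ⟨j, by omega⟩ ≤ L := by
    refine le_of_le_of_eq ?_ hgs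
    refine (Finset.sum_image (s := Finset.univ) (f := g)
      (g := fun j : Fin (T.k - 1) => (⟨j, by omega⟩ : Fin T.k)) ?_).symm.trans_le
      (Finset.sum_le_sum_of_subset_of_nonneg (Finset.subset_univ _) fun i _ _ => hg0 i)
    intro a _ b _ hab
    exact Fin.ext (by simpa using hab)
  have := mul_le_mul_of_nonneg_left (add_le_add hs1 hs2) (mul_nonneg two_pos.le hM)
  linarith

theorem abs_samplePoint_sub_le_of_mem_dualEdge (hh : T.h ≤ L / 2) (i : Fin T.k) {r : ℝ}
    (hr : r ∈ T.dualEdge i) : |T.samplePoint i.castSucc - r| ≤ 2 * T.h := by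
  have h1 := abs_le.1 (abs_samplePoint_sub_midpoint_le hh i.castSucc)
  have h2 := T.midpoint_succ_sub i
  have h3 := T.edgeLength_le_h i.castSucc
  have h4 := T.edgeLength_le_h i.succ
  rw [abs_le]
  constructor <;> linarith [hr.1, hr.2, T.h_pos]

theorem abs_energy_sub_le (H : IsApproxTangentField L M T.h τ κ θ θ')
    (hκ : ∀ s t, ‖κ s - κ t‖ ≤ M * |s - t|) (hκM : ∀ t, ‖κ t‖ ≤ M) (hκc : Continuous κ)
    (hh : T.h ≤ L / 2) (hhM : 4 * M * T.h ≤ 1) :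
    |(T.polygonOfTangents q fun I => θ (T.samplePoint I)).energy -
        1 / 2 * ∫ t in (0 : ℝ)..L, ‖κ t‖ ^ 2| ≤
      ((8 * M ^ 3 + 3 * M * ((7 + 2 / L) * M)) * L + M ^ 2) * T.h := by
  have hL := length_pos_of_h_le hh
  have hM : 0 ≤ M := (norm_nonneg _).trans (hκM 0)
  have hh0 := T.h_pos
  set P := T.polygonOfTangents q fun I => θ (T.samplePoint I) with hP
  -- Dividing by the squared dual length turns the discrete energy into a Riemann sum over dual
  -- edges, with `c i` in the role of `‖κ‖ ^ 2`.
  set c : Fin T.k → ℝ := fun i => P.turningAngle i ^ 2 / P.dualLength i ^ 2 with hc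
  set η := (8 * M ^ 3 + 3 * M * ((7 + 2 / L) * M)) * T.h with hη
  have hη0 : 0 ≤ η := by positivity
  have hgc : Continuous fun t => ‖κ t‖ ^ 2 := hκc.norm.pow 2
  have hcg : ∀ i : Fin T.k, ∀ t ∈ Icc (T.midpoint i.castSucc) (T.midpoint i.succ),
      ‖c i - ‖κ t‖ ^ 2‖ ≤ η := by
    intro i t ht
    have hpos := H.dualLength_pos (q := q) hh i
    have hle := H.dualLength_le (q := q) hh i
    have hb := H.norm_curvature_le (q := q) hh i
    have hk := H.norm_curvature_sub_curvature_le (q := q) hκ hh i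
      (abs_samplePoint_sub_le_of_mem_dualEdge hh i ht)
    rw [← hP] at hpos hle hb hk
    have htan : ∀ I, ‖P.tangent I‖ = 1 := fun I => by
      rw [hP, tangent_polygonOfTangents (H.norm_samplePoint hh), H.norm_samplePoint hh]
    have hdiff : ‖P.tangent i.castSucc - P.tangent i.succ‖ =
        P.dualLength i * ‖P.curvature i‖ := by
      rw [Polygon.curvature, norm_smul, norm_inv, Real.norm_of_nonneg hpos.le, ← mul_assoc,
        mul_inv_cancel₀ hpos.ne', one_mul, norm_sub_rev]
    have hsmall : P.dualLength i * ‖P.curvature i‖ ≤ 1 / 2 := by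
      have := mul_le_mul hle hb (norm_nonneg _) hh0.le
      linarith
    have hang := abs_sq_angle_sub_sq_norm_sub_le (htan i.castSucc) (htan i.succ)
      (by rw [hdiff]; exact hsmall)
    rw [hdiff] at hang
    have h1 : |c i - ‖P.curvature i‖ ^ 2| ≤ 8 * M ^ 3 * T.h := by
      have e : c i - ‖P.curvature i‖ ^ 2 = (P.turningAngle i ^ 2 -
          (P.dualLength i * ‖P.curvature i‖) ^ 2) / P.dualLength i ^ 2 := by
        rw [hc]; field_simp
      rw [e, abs_div, abs_of_pos (pow_pos hpos 2), div_le_iff₀ (pow_pos hpos 2)]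
      refine hang.trans ?_
      have h2 : P.dualLength i ^ 2 ≤ T.h ^ 2 := pow_le_pow_left₀ hpos.le hle 2
      have h3 : ‖P.curvature i‖ ^ 4 ≤ (2 * M) ^ 4 := pow_le_pow_left₀ (norm_nonneg _) hb 4
      have h4 : P.dualLength i ^ 2 * ‖P.curvature i‖ ^ 4 ≤ T.h ^ 2 * (2 * M) ^ 4 :=
        mul_le_mul h2 h3 (by positivity) (by positivity)
      -- The left side is `32 M⁴ h²`; one factor `4 M h ≤ 1` is spent to obtain a bound linear in
      -- `h`.
      have h5 : 2 * (T.h ^ 2 * (2 * M) ^ 4) ≤ 8 * M ^ 3 * T.h := by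
        have := mul_le_mul_of_nonneg_left hhM (show 0 ≤ 8 * M ^ 3 * T.h by positivity)
        linarith
      calc 2 * (P.dualLength i * ‖P.curvature i‖) ^ 4
          = 2 * (P.dualLength i ^ 2 * ‖P.curvature i‖ ^ 4) * P.dualLength i ^ 2 := by ring
        _ ≤ _ := mul_le_mul_of_nonneg_right (by linarith) (sq_nonneg _)
    have h2 : |‖P.curvature i‖ ^ 2 - ‖κ t‖ ^ 2| ≤ 3 * M * ((7 + 2 / L) * M) * T.h := by
      have e : ‖P.curvature i‖ ^ 2 - ‖κ t‖ ^ 2 =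
          (‖P.curvature i‖ + ‖κ t‖) * (‖P.curvature i‖ - ‖κ t‖) := by ring
      rw [e, abs_mul, abs_of_nonneg (by positivity)]
      have h3 := (abs_norm_sub_norm_le (P.curvature i) (κ t)).trans hk
      have h4 : ‖P.curvature i‖ + ‖κ t‖ ≤ 3 * M := by linarith [hκM t]
      exact (mul_le_mul h4 h3 (abs_nonneg _) (by positivity)).trans_eq (by ring)
    rw [Real.norm_eq_abs]
    refine (abs_sub_le _ (‖P.curvature i‖ ^ 2) _).trans ?_
    rw [hη]; linarith
  have hsum := norm_sum_smul_sub_integral_le T.midpoint_strictMono.monotone hgc hcg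
  have hen : ∑ i : Fin T.k, (T.midpoint i.succ - T.midpoint i.castSucc) • c i =
      ∑ i : Fin T.k, P.turningAngle i ^ 2 / P.dualLength i := by
    refine Finset.sum_congr rfl fun i _ => ?_
    have hpos := H.dualLength_pos (q := q) hh i
    rw [← dualLength_polygonOfTangents (q := q) (H.norm_samplePoint hh), ← hP, hc, smul_eq_mul]
    rw [← hP] at hpos
    field_simp
  rw [hen, Real.norm_eq_abs] at hsum
  have hm0 := T.midpoint_zero
  have hml := T.midpoint_last
  have he0 := T.edgeLength_le_h 0
  have hel := T.edgeLength_le_h (Fin.last T.k)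
  have hp0 := T.edgeLength_pos 0
  have hpl := T.edgeLength_pos (Fin.last T.k)
  have hb : ∀ a b, a ≤ b → |∫ t in a..b, ‖κ t‖ ^ 2| ≤ M ^ 2 * (b - a) := fun a b hab => by
    have := intervalIntegral.norm_integral_le_of_norm_le_const (a := a) (b := b)
      (f := fun t => ‖κ t‖ ^ 2) (C := M ^ 2) (fun t _ => by
        rw [Real.norm_of_nonneg (sq_nonneg _)]
        exact pow_le_pow_left₀ (norm_nonneg _) (hκM t) 2)
    rwa [Real.norm_eq_abs, abs_of_nonneg (sub_nonneg.2 hab)] at this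
  have hb1 := hb 0 (T.midpoint 0) (by linarith)
  have hb2 := hb (T.midpoint (Fin.last T.k)) L (by linarith)
  have hsplit : ∫ t in (0 : ℝ)..L, ‖κ t‖ ^ 2 = (∫ t in (0 : ℝ)..T.midpoint 0, ‖κ t‖ ^ 2) +
      (∫ t in T.midpoint 0..T.midpoint (Fin.last T.k), ‖κ t‖ ^ 2) +
      ∫ t in T.midpoint (Fin.last T.k)..L, ‖κ t‖ ^ 2 := by
    rw [intervalIntegral.integral_add_adjacent_intervals (hgc.intervalIntegrable _ _)
      (hgc.intervalIntegrable _ _), intervalIntegral.integral_add_adjacent_intervals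
      (hgc.intervalIntegrable _ _) (hgc.intervalIntegrable _ _)]
  -- The dual edges miss half of the first and half of the last edge, of total length at most `h`.
  have hend : M ^ 2 * (T.midpoint 0 - 0) + M ^ 2 * (L - T.midpoint (Fin.last T.k)) ≤
      M ^ 2 * T.h := by
    rw [← mul_add]
    exact mul_le_mul_of_nonneg_left (by linarith) (sq_nonneg M)
  have hηL : η * (T.midpoint (Fin.last T.k) - T.midpoint 0) ≤ η * L :=
    mul_le_mul_of_nonneg_left (by linarith) hη0
  have hM2 : 0 ≤ M ^ 2 * T.h := by positivity
  have hηL0 : 0 ≤ η * L := by positivity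
  rw [Polygon.energy, ← mul_sub, abs_mul, hsplit]
  have e : ((8 * M ^ 3 + 3 * M * ((7 + 2 / L) * M)) * L + M ^ 2) * T.h =
      η * L + M ^ 2 * T.h := by rw [hη]; ring
  rw [e, abs_of_pos (by norm_num : (0 : ℝ) < 1 / 2)]
  have h1 := abs_le.1 hsum
  have h2 := abs_le.1 hb1
  have h3 := abs_le.1 hb2
  have : |∑ i : Fin T.k, P.turningAngle i ^ 2 / P.dualLength i -
      ((∫ t in (0 : ℝ)..T.midpoint 0, ‖κ t‖ ^ 2) +
      (∫ t in T.midpoint 0..T.midpoint (Fin.last T.k), ‖κ t‖ ^ 2) +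
      ∫ t in T.midpoint (Fin.last T.k)..L, ‖κ t‖ ^ 2)| ≤ η * L + M ^ 2 * T.h := by
    rw [abs_le]
    constructor <;> linarith [h1.1, h1.2, h2.1, h2.2, h3.1, h3.2]
  linarith

end IsApproxTangentField

end Elastica

/-! ### Assembly of the sampling operator -/

namespace Elastica

variable {m : ℕ} {L : ℝ}

/-- The bending energy of a curve with unit tangent `τ` and curvature `κ`. -/
theorem bendingEnergy_eq (hL : 0 < L) {γ : Curve m L} {K : ℝ} {B : BoundaryData m} {τ κ : ℝ → E m}
    (h : IsTangentField L K B τ κ) (hv : velocity hL γ =ᵐ[intervalMeasure L] τ)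
    (hκ : ∀ t ∈ Icc 0 L, curvature hL γ t = κ t) :
    bendingEnergy hL γ = 1 / 2 * ∫ t in (0 : ℝ)..L, ‖κ t‖ ^ 2 := by
  rw [bendingEnergy, intervalIntegral.integral_of_le hL.le, integral_Ioc_eq_integral_Ioo]
  congr 1
  refine integral_congr_ae ?_
  filter_upwards [hv, ae_intervalMeasure_of_forall fun t ht => hκ t (Ioo_subset_Icc_self ht),
    ae_intervalMeasure_of_forall fun t ht => h.norm_eq_one t (Ioo_subset_Icc_self ht)]
    with t h1 h2 h3
  rw [h1, h2, h3, mul_one]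

/-- `M` adds up the constants of the separate tilt estimates, so that it dominates each. In the
factor `R + 1`, `R` serves the `O(h)` bound and `1` the absolute bound on the derivative. -/
theorem IsTangentField.isApproxTangentField_tilt {K R M h : ℝ} {B : BoundaryData m}
    {τ κ : ℝ → E m} {v : E m} (H : IsTangentField L K B τ κ) (hL : 0 < L) (hh : 0 ≤ h)
    (hR : 0 ≤ R) (hv : ‖v‖ ≤ R * h) (hRh : L ^ 2 * (R * h) ≤ 1 / 2) (hRh1 : R * h ≤ 1)
    (hM : M = 1 + K + 4 * L ^ 2 * R + (4 * L + 24 * L ^ 2 * K) * (R + 1) +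
      (4 * (K + 2) + 24 * (K + L) ^ 2)) :
    IsApproxTangentField L M h τ κ (tilt L τ v) (tiltDeriv L τ κ v) := by
  have hK := H.bound_nonneg
  have hv1 : ‖v‖ ≤ 1 := hv.trans hRh1
  have hv2 : L ^ 2 * ‖v‖ ≤ 1 / 2 :=
    (mul_le_mul_of_nonneg_left hv (sq_nonneg L)).trans hRh
  have p1 : 0 ≤ 4 * L ^ 2 * R := by positivity
  have p2 : 0 ≤ 4 * L + 24 * L ^ 2 * K := by positivity
  have p3 : 0 ≤ 4 * (K + 2) + 24 * (K + L) ^ 2 := by positivity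
  have p4 : 0 ≤ (4 * L + 24 * L ^ 2 * K) * R := by positivity
  refine ⟨fun s hs => H.hasDerivAt_tilt hv2 hs, fun s hs => H.norm_tilt hv2 hs, fun s hs => ?_,
    fun s hs => ?_, fun s hs t ht => ?_, fun s hs => ?_⟩
  · calc _ ≤ 4 * L ^ 2 * ‖v‖ := H.norm_tilt_sub_le hv2 hs
      _ ≤ 4 * L ^ 2 * (R * h) := mul_le_mul_of_nonneg_left hv (by positivity)
      _ = 4 * L ^ 2 * R * h := by ring
      _ ≤ M * h := mul_le_mul_of_nonneg_right (by linarith) hh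
  · calc _ ≤ (4 * L + 24 * L ^ 2 * K) * ‖v‖ := H.norm_tiltDeriv_sub_curvature_le hL hv2 hs
      _ ≤ (4 * L + 24 * L ^ 2 * K) * (R * h) := mul_le_mul_of_nonneg_left hv p2
      _ = (4 * L + 24 * L ^ 2 * K) * R * h := by ring
      _ ≤ M * h := mul_le_mul_of_nonneg_right (by linarith) hh
  · exact (H.norm_tiltDeriv_sub_le hv2 hv1 hs ht).trans
      (mul_le_mul_of_nonneg_right (by linarith) (abs_nonneg _))
  · have h1 := H.norm_tiltDeriv_sub_curvature_le hL hv2 hs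
    have h2 := mul_le_mul_of_nonneg_left hv1 p2
    have h3 := norm_sub_norm_le (tiltDeriv L τ κ v s) (κ s)
    linarith [H.norm_curvature_le s]

/-- Every curve with a Lipschitz continuous curvature is approximated by a feasible polygon. -/
theorem exists_polygon_approx (hL : 0 < L) (p : ℝ≥0∞) (B : BoundaryData m) (K₁ : ℝ≥0) :
    ∃ h₀ : ℝ, 0 < h₀ ∧ h₀ ≤ L / 2 ∧ ∃ C : ℝ, 0 ≤ C ∧ ∃ K₂ : ℝ, 0 ≤ K₂ ∧
      ∀ T : IntervalPartition L, T.h ≤ h₀ → ∀ γ ∈ smoothPriors hL p B K₁,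
        ∃ P ∈ T.feasible B,
          |P.energy - bendingEnergy hL γ| ≤ C * T.h ∧
          sobolevNorm L 1 ⊤ (fun t => P.interp t - γ.extend hL t) ≤ ENNReal.ofReal (C * T.h) ∧
          (∀ i : Fin T.k, ∀ r ∈ Icc 0 L, |T.samplePoint i.castSucc - r| ≤ 2 * T.h →
            ‖P.curvature i - curvature hL γ r‖ ≤ C * T.h) ∧
          (∀ i : Fin T.k, ‖P.curvature i‖ ≤ K₂) ∧ P.seminormTV3 ≤ K₂ := by
  have hK : (0 : ℝ) ≤ K₁ := K₁.2
  obtain ⟨R, hR, h₁, hh₁, hclose⟩ := exists_tilt_closing_up hL hK B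
  obtain ⟨M, hM⟩ : ∃ M : ℝ, M = 1 + K₁ + 4 * L ^ 2 * R + (4 * L + 24 * L ^ 2 * K₁) * (R + 1) +
    (4 * (K₁ + 2) + 24 * (K₁ + L) ^ 2) := ⟨_, rfl⟩
  have hMK : (K₁ : ℝ) ≤ M := by
    have p1 : 0 ≤ 4 * L ^ 2 * R := by positivity
    have p2 : 0 ≤ (4 * L + 24 * L ^ 2 * K₁) * (R + 1) := by positivity
    have p3 : 0 ≤ 4 * ((K₁ : ℝ) + 2) + 24 * (K₁ + L) ^ 2 := by positivity
    linarith
  have hM0 : 0 < M := by rw [hM]; positivity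
  set C₁ := (8 * M ^ 3 + 3 * M * ((7 + 2 / L) * M)) * L + M ^ 2 with hC₁
  set C₂ := 2 * M * (L + 1) with hC₂
  set C₃ := (7 + 2 / L) * M with hC₃
  have hC₁0 : 0 ≤ C₁ := by positivity
  have hC₂0 : 0 ≤ C₂ := by positivity
  have hC₃0 : 0 ≤ C₃ := by positivity
  -- The third bound on `h` gives `L² R h ≤ 1 / 2` and `R h ≤ 1`; the last keeps the turning chords
  -- below `1 / 2` for the angle estimate.
  refine ⟨min (min (L / 2) h₁) (min (1 / (2 * L ^ 2 * R + R + 1)) (1 / (4 * M))),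
    by positivity, (min_le_left _ _).trans (min_le_left _ _), C₁ + C₂ + C₃, by positivity,
    2 * M + 4 * M * L, by positivity, fun T hT γ hγ => ?_⟩
  have hT1 : T.h ≤ L / 2 := hT.trans ((min_le_left _ _).trans (min_le_left _ _))
  have hT2 : T.h ≤ h₁ := hT.trans ((min_le_left _ _).trans (min_le_right _ _))
  have hT3 : T.h * (2 * L ^ 2 * R + R + 1) ≤ 1 := (le_div_iff₀ (by positivity)).1
    (hT.trans ((min_le_right _ _).trans (min_le_left _ _)))
  have hT4 : T.h * (4 * M) ≤ 1 := (le_div_iff₀ (by positivity)).1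
    (hT.trans ((min_le_right _ _).trans (min_le_right _ _)))
  have hh := T.h_pos
  have q1 : 0 ≤ T.h * R := by positivity
  have q2 : 0 ≤ T.h * (2 * L ^ 2 * R) := by positivity
  obtain ⟨τ, κ, H, hγτ, hvel, hcurv⟩ := exists_isTangentField_of_mem_smoothPriors hL hγ
  obtain ⟨v, hv, hsum⟩ := hclose τ κ H T hT2
  have A := H.isApproxTangentField_tilt (h := T.h) (M := M) hL hh.le hR hv (by linarith)
    (by linarith) hM
  have hlip : ∀ s t, ‖κ s - κ t‖ ≤ M * |s - t| := fun s t =>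
    (H.lipschitz s t).trans (mul_le_mul_of_nonneg_right hMK (abs_nonneg _))
  have hbd : ∀ t, ‖κ t‖ ≤ M := fun t => (H.norm_curvature_le t).trans hMK
  have hunit := A.norm_samplePoint hT1
  refine ⟨T.polygonOfTangents B.startPoint fun I => tilt L τ v (T.samplePoint I),
    IntervalPartition.polygonOfTangents_mem_feasible hunit ?_ ?_ hsum, ?_, ?_, ?_, ?_, ?_⟩
  · rw [T.samplePoint_zero, H.tilt_zero_eq hL, H.zero_eq]
  · rw [IntervalPartition.samplePoint_last hT1, H.tilt_last_eq hL, H.last_eq]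
  · rw [bendingEnergy_eq hL H hvel hcurv]
    refine (A.abs_energy_sub_le hlip hbd H.continuous_curvature hT1 (by linarith)).trans ?_
    exact mul_le_mul_of_nonneg_right (by linarith) hh.le
  -- An edge direction differs from `τ t` on its edge by `M h` from the tilt and `M h` from sampling
  -- at distance at most `h`.
  · have h1 := IntervalPartition.Polygon.sobolevNorm_interp_sub_le hL
      (T.polygonOfTangents B.startPoint fun I => tilt L τ v (T.samplePoint I)) (c := 2 * M * T.h)
      H.continuous (u := γ.extend hL)
      (by rw [IntervalPartition.polygonOfTangents_zero]; exact hγτ) (fun I t ht => by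
        rw [IntervalPartition.polygonOfTangents_succ_sub, smul_smul,
          inv_mul_cancel₀ (T.edgeLength_pos I).ne', one_smul]
        have h2 := A.norm_sub_le _ (IntervalPartition.samplePoint_mem hT1 I)
        have h3 := (H.norm_sub_le (T.samplePoint I) t).trans (mul_le_mul hMK
          (IntervalPartition.abs_samplePoint_sub_le hT1 I ht) (abs_nonneg _) hM0.le)
        refine (norm_sub_le_norm_sub_add_norm_sub _ (τ (T.samplePoint I)) _).trans ?_
        linarith)
    refine h1.trans (ENNReal.ofReal_le_ofReal ?_)
    have : 2 * M * T.h * (L + 1) = C₂ * T.h := by rw [hC₂]; ring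
    rw [this]
    exact mul_le_mul_of_nonneg_right (by linarith) hh.le
  · intro i r hr hir
    rw [hcurv r hr]
    exact (A.norm_curvature_sub_curvature_le hlip hT1 i hir).trans
      (mul_le_mul_of_nonneg_right (by linarith) hh.le)
  · intro i
    refine (A.norm_curvature_le hT1 i).trans ?_
    have : 0 ≤ 4 * M * L := by positivity
    linarith
  · refine (A.seminormTV3_le hT1).trans ?_
    linarith

end Elastica

theorem mainTheorem5 (m : ℕ) (L : ℝ) (hL : 0 < L) (p : ℝ≥0∞) (hp : 2 ≤ p)
    (B : BoundaryData m) (K₁ : ℝ≥0) :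
    ∃ h₀ : ℝ, 0 < h₀ ∧ ∃ C : ℝ, 0 ≤ C ∧ ∃ K₂ : ℝ, 0 ≤ K₂ ∧
      ∀ T : IntervalPartition L, T.h ≤ h₀ → ∃ hk : 0 < T.k,
        ∃ S : smoothPriors hL p B K₁ → T.feasible B,
          (∀ γ : smoothPriors hL p B K₁,
            |(S γ).1.energy - bendingEnergy hL γ.1| ≤ C * T.h) ∧
          (∀ γ : smoothPriors hL p B K₁,
            sobolevNorm L 1 ⊤ (fun t => (S γ).1.interp t - γ.1.extend hL t)
              ≤ ENNReal.ofReal (C * T.h)) ∧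
          (∀ γ : smoothPriors hL p B K₁, ∀ i : Fin T.k, ∀ r ∈ T.dualEdge i,
            ‖(S γ).1.curvature i - curvature hL γ.1 r‖ ≤ C * T.h) ∧
          (∀ γ : smoothPriors hL p B K₁, ∀ r ∈ T.edge 0,
            ‖(S γ).1.curvature ⟨0, hk⟩ - curvature hL γ.1 r‖ ≤ C * T.h) ∧
          (∀ γ : smoothPriors hL p B K₁, ∀ r ∈ T.edge (Fin.last T.k),
            ‖(S γ).1.curvature ⟨T.k - 1, by omega⟩ - curvature hL γ.1 r‖ ≤ C * T.h) ∧
          (∀ γ : smoothPriors hL p B K₁, (S γ).1 ∈ T.priors B K₂) := by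
  obtain ⟨h₀, hh₀, hh₀L, C, hC, K₂, hK₂, H⟩ := exists_polygon_approx hL p B K₁
  refine ⟨h₀, hh₀, C, hC, K₂, hK₂, fun T hT => ?_⟩
  have hh : T.h ≤ L / 2 := hT.trans hh₀L
  have hk : 0 < T.k := T.k_pos_of_h_lt (by linarith)
  -- The polygon is chosen separately for each curve; uniformity lies in the constants, fixed before
  -- `T` and `γ`.
  choose S hS hE hW hκ hb hTV using fun γ : smoothPriors hL p B K₁ => H T hT γ.1 γ.2
  have hhpos := T.h_pos
  refine ⟨hk, fun γ => ⟨S γ, hS γ⟩, hE, hW, fun γ i r hr => ?_, fun γ r hr => ?_,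
    fun γ r hr => ?_, fun γ => ⟨hS γ, ?_, hTV γ⟩⟩
  -- All three curvature estimates come from the same bound, valid for `r` within `2 h` of the
  -- sample point of the preceding edge.
  · have h1 := T.edge_subset i.castSucc
      ⟨(T.strictMono (Fin.castSucc_lt_succ (i := i.castSucc))).le, le_rfl⟩
    refine hκ γ i r ⟨?_, ?_⟩ (IsApproxTangentField.abs_samplePoint_sub_le_of_mem_dualEdge hh i hr)
    · refine le_trans ?_ hr.1
      rw [IntervalPartition.midpoint]
      linarith [(T.vertex_mem i.castSucc.castSucc).1, (T.vertex_mem i.castSucc.succ).1]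
    · refine hr.2.trans ?_
      rw [IntervalPartition.midpoint]
      linarith [(T.vertex_mem i.succ.castSucc).2, (T.vertex_mem i.succ.succ).2]
  · refine hκ γ ⟨0, hk⟩ r (T.edge_subset 0 hr) ?_
    have := IntervalPartition.abs_samplePoint_sub_le hh 0 hr
    have e : (Fin.castSucc ⟨0, hk⟩ : Fin (T.k + 1)) = 0 := rfl
    rw [e]
    linarith
  -- For the last edge, `r` is within `3 h / 2` of the midpoint of the preceding edge, and the
  -- sample point is within `h / 2` of that midpoint.
  · refine hκ γ ⟨T.k - 1, by omega⟩ r (T.edge_subset _ hr) ?_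
    have e : (Fin.succ ⟨T.k - 1, by omega⟩ : Fin (T.k + 1)) = Fin.last T.k :=
      Fin.ext (by simp; omega)
    have h1 := abs_le.1 (IntervalPartition.abs_samplePoint_sub_midpoint_le hh
      (Fin.castSucc ⟨T.k - 1, by omega⟩))
    have h2 := T.midpoint_succ_sub ⟨T.k - 1, by omega⟩
    rw [e] at h2
    have h3 := T.edgeLength_le_h (Fin.castSucc ⟨T.k - 1, by omega⟩)
    have h4 := T.edgeLength_le_h (Fin.last T.k)
    have h5 := T.midpoint_last
    have h6 := T.castSucc_vertex_add_edgeLength (Fin.last T.k)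
    have h7 : T.vertex (Fin.last T.k).succ = L := T.vertex_last
    have h8 := T.edgeLength_pos (Fin.castSucc ⟨T.k - 1, by omega⟩)
    have h9 := T.edgeLength_pos (Fin.last T.k)
    rw [IntervalPartition.edge, mem_Icc] at hr
    rw [abs_le]
    constructor <;> linarith [hr.1, hr.2]
  · have : Nonempty (Fin T.k) := ⟨⟨0, hk⟩⟩
    exact ciSup_le (hb γ)
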